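/- **Programs.** Fix sets of threads, addresses $\mathit{Adr}$ and data values $\mathit{Dom}$ (with a default value $0$), and a finite set of SMR functions containing $\mathtt{retire}$, which takes one pointer. A program $P$ is built by $;$, $\oplus$ and ${}^*$ from the commands $p:=q$, $p:=q.\mathtt{next}$, $p.\mathtt{next}:=q$, $u:=q.\mathtt{data}$, $p.\mathtt{data}:=u$, $u:=op(\vec u)$, $p:=\mathtt{malloc}$, $\mathtt{assume}\ cond$ (with $cond$ being $p=q$, $p\neq q$ or a predicate on data), $\mathtt{beginAtomic}$, $\mathtt{endAtomic}$, $\mathtt{enter}\ f(\vec p,\vec u)$, $\mathtt{exit}\ f$, and the annotations $\mathtt{angel}\ r$, $p=q$, $p\in r$, $\mathtt{active}(p)$, $\mathtt{active}(r)$. Pointer variables are shared or thread-local; data variables and angels are thread-local. All threads execute $P$ concurrently; commands are executed inside atomic blocks, during which neither another thread nor a $\mathtt{free}$ interferes. **Semantics.** Computations are sequences of actions, each being a command executed by a thread with its memory updates, or a $\mathtt{free}(a)$ by the environment. Pointers have values in $\mathit{Adr}\cup\{\mathtt{seg}\}$; initially all pointer variables are $\mathtt{seg}$, all data variables are $0$,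 and the selectors $a.\mathtt{next}$, $a.\mathtt{data}$ are undefined. Dereferencing is enabled if the pointer is not $\mathtt{seg}$ and the selector read is defined; $\mathtt{enter}$ is enabled if no pointer argument is $\mathtt{seg}$. After $\tau$, an address is *fresh* if it was never allocated or freed, *freed* if it was freed and not reallocated since, *retired* if it was retired and not freed since, and *active* if it is neither freed nor retired. $[\![P]\!]_X^Y$ is the set of computations of $P$ that free only addresses in $X$, where $\mathtt{malloc}$ returns a fresh address or a freed address in $Y$. The garbage-collected semantics is $[\![P]\!]_\emptyset^\emptyset$. The history $\mathcal H(\tau)$ is the sequence of events $f(t,\vec a,\vec d)$, $\mathtt{exit}\,f(t)$ and $\mathtt{free}(a)$ in $\tau$. For an SMR automaton $\mathcal O$ let $\mathcal O[\![P]\!]_X^Y=\{\tau\in[\![P]\!]_X^Y : \mathcal H(\tau)\in\mathcal S(\mathcal O)\}$. **SMR automata.** An SMR automaton is a finite automaton over events whose guards are Boolean combinations of equalities between event parameters and variables; data parameters may also be compared with constants. The variables, among them $z_t$ for threads and $z_a$ for addresses, are fixed by a valuation $\varphi$ chosen once before a run. The specification $\mathcal S(\mathcal O)$ is the set of histories that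 are accepted from the initial location under no valuation. A product accepts if a factor does, so specifications are intersected. $\mathit{Base}$ has locations $\mathit{init}$ (initial), $\mathit{retired}$ and $\mathit{final}$ (accepting), transitions $\mathit{init}\to\mathit{retired}$ on $\mathtt{retire}(\cdot,z_a)$, $\mathit{retired}\to\mathit{init}$ and $\mathit{init}\to\mathit{final}$ on $\mathtt{free}(z_a)$, and stays put otherwise. Let $\mathcal O=\mathit{Base}\times\mathcal B$ for an SMR automaton $\mathcal B$, and assume: - every event is enabled in every location of $\mathcal O$ under every valuation (undrawn events are self-loops); accepting locations are entered only by $\mathtt{free}$ and never left; - $\mathcal O$ *supports elision*. Let $\mathcal F(h,a)$ be the set of $h'$ with $h.h'\in\mathcal S(\mathcal O)$ such that $h'$ frees no address but $a$, and let $h[a/b]$ be $h$ with $a,b$ exchanged. Then for all $h,a,b,c$: (i) if $a\ne b$ and $h.\mathtt{free}(a)\in\mathcal S(\mathcal O)$ then $\mathcal F(h.\mathtt{free}(a),b)=\mathcal F(h,b)$; (ii) if $a\neq c\neq b$ then $\mathcal F(h,c)=\mathcal F(h[a/b],c)$; (iii) if $a$ is not retired after $h$ and $b$ does not occur in $h$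 then $\mathcal F(h,a)\subseteq\mathcal F(h[a/b],a)$; (iv) $\mathcal F(h.\mathtt{free}(a),a)\subseteq\mathcal F(h,a)$. **Invariants.** The annotations *hold* for $\sigma$ if the following formula is valid: reading $\sigma$ from left to right, $\mathtt{angel}\ r$ is an existential quantifier over sets $r$ of addresses that scopes over the rest, and the annotations $p=q$, $p\in r$, $\mathtt{active}(p)$, $\mathtt{active}(r)$ are conjuncts stating that, at that moment, $p$ and $q$ have the same value, the value of $p$ lies in $r$, the value of $p$ is an active address, all elements of $r$ are active. **Types.** A type is a set of guarantees $\mathbb L$, $\mathbb A$, $\mathbb S$, $\mathbb E_L$, where $L$ is a set of locations of $\mathcal O$ that is closed under interference, i.e. every transition on some $\mathtt{enter}\,f$ or $\mathtt{exit}\,f$ that leaves $L$ has a guard that implies that the acting thread is $z_t$. Put $Loc(\mathbb L)=Loc(\mathbb A)=\{\mathit{init}\}\times Loc(\mathcal B)$, $Loc(\mathbb E_L)=L$, and let $Loc(\mathbb S)$ be the largest closed set without a transition with satisfiable guard to a non-accepting location on $\mathtt{free}(z_a)$ (i.e. on a $\mathtt{free}$ whose guard implies that the freed address is $z_a$); $Loc(T)$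 is the intersection of the $Loc(g)$, $g\in T$. $T$ is *valid* if it meets $\{\mathbb S,\mathbb L,\mathbb A\}$. For a pointer or angel $x$, $post_{x,c}(L)$ is the set of locations reached from $L$ by a step on the event of $c$ executed by thread $\varphi(z_t)$ in some memory where $\varphi(z_a)$ is the value of $x$ (no constraint for angels). $T\rightsquigarrow_{x,c} T'$ means $post_{x,c}(Loc(T))\subseteq Loc(T')$, $T'$ valid implies $T$ valid, and $T'\cap\{\mathbb L,\mathbb A\}\subseteq T$; likewise $\rightsquigarrow_{\epsilon}$ with $Loc(T)$ for the post image. These lift pointwise to environments $\Gamma$, which give a type to every pointer and angel. Judgements $\{\Gamma\}\,s\,\{\Gamma'\}$ are derived by these rules (types not mentioned are unchanged): - $p:=q$: $p$ and $q$ get $\Gamma(q)\setminus\{\mathbb L\}$. $p:=q.\mathtt{next}$: needs $\Gamma(q)$ valid, $p$ gets $\emptyset$. $p.\mathtt{next}:=q$: needs $\Gamma(p)$ valid, $q$ loses $\mathbb L$. Reading or writing $p.\mathtt{data}$ needs $\Gamma(p)$ valid. $u:=op(\vec u)$: no premise. $p:=\mathtt{malloc}$: $p$ is local and gets $\{\mathbb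 L\}$. - $\mathtt{assume}\ p=q$: needs $\Gamma(p),\Gamma(q)$ valid, both get $(\Gamma(p)\cup\Gamma(q))\setminus\{\mathbb L\}$. Other assumptions: no premise. Annotation $p=q$: both get $\Gamma(p)\cup\Gamma(q)$. $\mathtt{active}(x)$: add $\mathbb A$ to $x$. $\mathtt{angel}\ r$: $r$ gets $\emptyset$. $p\in r$: add $\Gamma(r)$ to $p$. - $c=\mathtt{exit}\,f$: any $\Gamma'$ with $\Gamma\rightsquigarrow_c\Gamma'$. $c=\mathtt{enter}\ f(\vec p,\vec u)$: any $\Gamma'$ with $\Gamma\rightsquigarrow_c\Gamma'$, provided the call is safe and, if $f=\mathtt{retire}$, $\mathbb A\in\Gamma(p)$. *Safe*: for all $h,t,\vec a,\vec b,c,\vec d$, if $a_i=b_i$ for every $i$ with $a_i=c$ or $\Gamma(p_i)$ valid, then $\mathcal F(h.f(t,\vec b,\vec d),c)\subseteq\mathcal F(h.f(t,\vec a,\vec d),c)$. - $\mathtt{beginAtomic}$ changes nothing; $\mathtt{endAtomic}$ removes $\mathbb A$ everywhere and sets the types of shared pointers to $\emptyset$. $s_1;s_2$ composes; $s_1\oplus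 s_2$ needs the same judgement for both; $s^*$ needs $\{\Gamma\}s\{\Gamma\}$; and $\{\Gamma_1\}s\{\Gamma_4\}$ follows from $\Gamma_1\rightsquigarrow_\epsilon\Gamma_2$, $\{\Gamma_2\}s\{\Gamma_3\}$, $\Gamma_3\rightsquigarrow_\epsilon\Gamma_4$. $P$ *type checks* if $\{\Gamma_{init}\}P\{\Gamma\}$ is derivable for some $\Gamma$, where $\Gamma_{init}$ is constantly $\emptyset$. **Pointer races.** The valid pointer expressions ($p$ or $a.\mathtt{next}$) are initially all pointer variables. An assignment to a pointer variable or a $\mathtt{next}$ selector makes its target valid or invalid according to its source; $\mathtt{free}(a)$ invalidates $a.\mathtt{next}$ and all expressions with value $a$; $p:=\mathtt{malloc}$ returning $a$ makes $p$ and $a.\mathtt{next}$ valid; $\mathtt{assume}\ p=q$ makes both valid if one is. A computation $\tau.act$ *raises a pointer race* if $act$ (1) dereferences a pointer that is invalid after $\tau$, (2) is an $\mathtt{assume}\ p=q$ with $p$ or $q$ invalid, (3) retires an invalid pointer, or (4) is an unsafe call: an $\mathtt{enter}\ f(\vec p,\vec u)$ by $t$ with some $p_i$ invalid such that, for the values $\vec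 a,\vec d$ of $\vec p,\vec u$ and $h=\mathcal H(\tau)$, there are $c,\vec b$ with $a_i=b_i$ for every $i$ with $a_i=c$ or $p_i$ valid, and $\mathcal F(h.f(t,\vec b,\vec d),c)\not\subseteq\mathcal F(h.f(t,\vec a,\vec d),c)$. **Proposition.** If the annotations hold for every $\sigma\in[\![P]\!]_\emptyset^\emptyset$ and $P$ type checks, then $\mathcal O[\![P]\!]_{\mathit{Adr}}^{\emptyset}$, the SMR semantics without reallocation, is pointer-race-free: no prefix of any of its computations raises a pointer race. -/

import Mathlib

/-! Concurrent pointer programs with safe memory reclamation (SMR), SMR automata,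
the type system relative to an SMR automaton, and pointer races. -/

universe u

namespace SMR

/-- The fixed data: threads, addresses, the data domain with its default value, and the functions
other than `retire` offered by the SMR algorithm, with their numbers of pointer and data arguments. -/
structure Sig where
  Thread : Type u
  Adr : Type u
  Dom : Type u
  zero : Dom
  F : Type
  finF : Finite F
  nPtr : F → ℕ
  nDat : F → ℕ

/-- SMR function names; `retire` takes exactly one pointer. -/
inductive Fn (F : Type) : Type
  | retire : Fn F
  | op : F → Fn F

def Sig.ptrAr (S : Sig.{u}) : Fn S.F → ℕ
  | .retire => 1
  | .op f => S.nPtr f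

def Sig.datAr (S : Sig.{u}) : Fn S.F → ℕ
  | .retire => 0
  | .op f => S.nDat f

/-- The argument position of `retire`. -/
def Sig.retArg (S : Sig.{u}) : Fin (S.ptrAr .retire) := ⟨0, Nat.one_pos⟩

/-! ### SMR automata -/

/-- Events: `free(a)`, `f(t, a₁ … aₙ, d₁ … dₘ)` for the invocation of an SMR function by thread `t`,
and `exit f(t)` for its return. -/
inductive Event (S : Sig.{u}) : Type u
  | free (a : S.Adr)
  | enter (f : Fn S.F) (t : S.Thread) (as : Fin (S.ptrAr f) → S.Adr) (ds : Fin (S.datAr f) → S.Dom)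
  | exit (f : Fn S.F) (t : S.Thread)

/-- Event types, labelling the transitions of an SMR automaton. -/
inductive Label (S : Sig.{u}) : Type
  | free
  | enter (f : Fn S.F)
  | exit (f : Fn S.F)

variable {S : Sig.{u}}

def Label.nThr : Label S → ℕ
  | .free => 0
  | .enter _ => 1
  | .exit _ => 1

def Label.nAdr : Label S → ℕ
  | .free => 1
  | .enter f => S.ptrAr f
  | .exit _ => 0

def Label.nDat : Label S → ℕ
  | .free => 0
  | .enter f => S.datAr f
  | .exit _ => 0

def Event.label : Event S → Label S
  | .free _ => .free
  | .enter f _ _ _ => .enter f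
  | .exit f _ => .exit f

/-- Actual values for the formal parameters of an event type. -/
structure Params (S : Sig.{u}) (l : Label S) where
  thr : Fin l.nThr → S.Thread
  adr : Fin l.nAdr → S.Adr
  dat : Fin l.nDat → S.Dom

def Event.params : (e : Event S) → Params S e.label
  | .free a => ⟨fun i => i.elim0, fun _ => a, fun i => i.elim0⟩
  | .enter _ t as ds => ⟨fun _ => t, as, ds⟩
  | .exit _ t => ⟨fun _ => t, fun i => i.elim0, fun i => i.elim0⟩

/-- Thread variables of an automaton: the distinguished `z_t` and further ones. -/
inductive TVar (X : Type) : Type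
  | zt : TVar X
  | extra : X → TVar X

/-- Address variables of an automaton: the distinguished `z_a` and further ones. -/
inductive ZVar (Y : Type) : Type
  | za : ZVar Y
  | extra : Y → ZVar Y

/-- A valuation of the variables of an automaton. -/
structure Valu (S : Sig.{u}) (X Y : Type) where
  thr : TVar X → S.Thread
  adr : ZVar Y → S.Adr

/-- A term is a variable or a formal parameter. -/
inductive Term (V : Type) (n : ℕ) : Type
  | var : V → Term V n
  | param : Fin n → Term V n

def Term.eval {V : Type} {n : ℕ} {D : Type u} (v : V → D) (p : Fin n → D) : Term V n → D
  | .var x => v x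
  | .param i => p i

/-- Guards: Boolean formulas over equalities of variables and parameters (a data parameter may also
be compared with a constant). -/
inductive Guard (S : Sig.{u}) (X Y : Type) (l : Label S) : Type u
  | tt : Guard S X Y l
  | thrEq : Term (TVar X) l.nThr → Term (TVar X) l.nThr → Guard S X Y l
  | adrEq : Term (ZVar Y) l.nAdr → Term (ZVar Y) l.nAdr → Guard S X Y l
  | datEq : Fin l.nDat → Fin l.nDat → Guard S X Y l
  | datConst : Fin l.nDat → S.Dom → Guard S X Y l
  | not : Guard S X Y l → Guard S X Y l
  | and : Guard S X Y l → Guard S X Y l → Guard S X Y l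
  | or : Guard S X Y l → Guard S X Y l → Guard S X Y l

def Guard.eval {X Y : Type} {l : Label S} (φ : Valu S X Y) (p : Params S l) :
    Guard S X Y l → Prop
  | .tt => True
  | .thrEq x y => x.eval φ.thr p.thr = y.eval φ.thr p.thr
  | .adrEq x y => x.eval φ.adr p.adr = y.eval φ.adr p.adr
  | .datEq i j => p.dat i = p.dat j
  | .datConst i d => p.dat i = d
  | .not g => ¬ g.eval φ p
  | .and g g' => g.eval φ p ∧ g'.eval φ p
  | .or g g' => g.eval φ p ∨ g'.eval φ p

/-- SMR automata with thread variables `TVar X` and address variables `ZVar Y`.  The transitions are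
given separately for each event type, as triples (source, guard, target). -/
structure Aut (S : Sig.{u}) (X Y : Type) where
  Loc : Type
  finLoc : Finite Loc
  init : Loc
  acc : Set Loc
  trans : (l : Label S) → Set (Loc × Guard S X Y l × Loc)
  finTrans : ∀ l, (trans l).Finite

variable {X Y : Type}

/-- `(l, φ)` steps to `(l', φ)` under the event `e`. -/
def Aut.Step (A : Aut S X Y) (φ : Valu S X Y) (l : A.Loc) (e : Event S) (l' : A.Loc) : Prop :=
  ∃ g, (l, g, l') ∈ A.trans e.label ∧ g.eval φ e.params

/-- `(l, φ)` reaches `(l', φ)` under a history (events in chronological order). -/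
def Aut.Run (A : Aut S X Y) (φ : Valu S X Y) : A.Loc → List (Event S) → A.Loc → Prop
  | l, [], l' => l = l'
  | l, e :: h, l' => ∃ l₁, A.Step φ l e l₁ ∧ A.Run φ l₁ h l'

/-- The specification: the histories that are not accepted. -/
def Aut.Spec (A : Aut S X Y) : Set (List (Event S)) :=
  {h | ∀ φ l', A.Run φ A.init h l' → l' ∉ A.acc}

/-- Continuations of `h` inside the specification that free at most the address `a`. -/
def Aut.Freeable (A : Aut S X Y) (h : List (Event S)) (a : S.Adr) : Set (List (Event S)) :=
  {h' | h ++ h' ∈ A.Spec ∧ ∀ b, Event.free b ∈ h' → b = a}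

/-- The product automaton; it accepts if one of the factors does, so that the specifications are
intersected. -/
def Aut.prod (A B : Aut S X Y) : Aut S X Y where
  Loc := A.Loc × B.Loc
  finLoc := by
    have := A.finLoc
    have := B.finLoc
    infer_instance
  init := (A.init, B.init)
  acc := {l | l.1 ∈ A.acc ∨ l.2 ∈ B.acc}
  trans := fun l => Set.image2
    (fun x y => ((x.1, y.1), Guard.and x.2.1 y.2.1, (x.2.2, y.2.2))) (A.trans l) (B.trans l)
  finTrans := fun l => (A.finTrans l).image2 _ (B.finTrans l)

inductive BaseLoc : Type
  | init | retired | final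

/-- The guard `a = z_a` for the parameter `a` of `free`. -/
def freeZa : Guard S X Y .free :=
  .adrEq (.param (show Fin (Label.nAdr (S := S) .free) from ⟨0, Nat.one_pos⟩)) (.var .za)

/-- The guard `a = z_a` for the parameter `a` of `retire`. -/
def retireZa : Guard S X Y (.enter .retire) :=
  .adrEq (.param (show Fin (Label.nAdr (S := S) (.enter .retire)) from S.retArg)) (.var .za)

/-- The transitions of the base automaton, including the self loops. -/
def baseTrans : (l : Label S) → Set (BaseLoc × Guard S X Y l × BaseLoc)
  | .free =>
      {(.init, freeZa, .final), (.init, .not freeZa, .init),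
       (.retired, freeZa, .init), (.retired, .not freeZa, .retired), (.final, .tt, .final)}
  | .enter .retire =>
      {(.init, retireZa, .retired), (.init, .not retireZa, .init),
       (.retired, .tt, .retired), (.final, .tt, .final)}
  | .enter (.op _) => {(.init, .tt, .init), (.retired, .tt, .retired), (.final, .tt, .final)}
  | .exit _ => {(.init, .tt, .init), (.retired, .tt, .retired), (.final, .tt, .final)}

/-- The base automaton: `z_a` may be freed only if it has been retired and not been freed since. -/
def base (S : Sig.{u}) (X Y : Type) : Aut S X Y where
  Loc := BaseLoc
  finLoc := Finite.of_surjective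
    (fun i : Fin 3 => if i = 0 then BaseLoc.init else if i = 1 then .retired else .final)
    (by rintro (_ | _ | _); exacts [⟨0, rfl⟩, ⟨1, rfl⟩, ⟨2, rfl⟩])
  init := .init
  acc := {.final}
  trans := baseTrans
  finTrans := by
    intro l
    rcases l with _ | (_ | f) | f <;> simp [baseTrans]

/-- The product of the base automaton with a further automaton. -/
abbrev Aut.full (B : Aut S X Y) : Aut S X Y := (base S X Y).prod B

/-! ### Assumptions on SMR automata -/

/-- Apply a map to the addresses of an event. -/
def Event.mapAdr (r : S.Adr → S.Adr) : Event S → Event S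
  | .free a => .free (r a)
  | .enter f t as ds => .enter f t (fun i => r (as i)) ds
  | .exit f t => .exit f t

open Classical in
/-- Exchange of the addresses `a` and `b` in a history. -/
noncomputable def rename (h : List (Event S)) (a b : S.Adr) : List (Event S) :=
  h.map (Event.mapAdr (Equiv.swap a b))

def Event.adrs : Event S → Set S.Adr
  | .free a => {a}
  | .enter _ _ as _ => Set.range as
  | .exit _ _ => ∅

/-- Addresses that are fresh in a history. -/
def freshH (h : List (Event S)) : Set S.Adr := {a | ∀ e ∈ h, a ∉ e.adrs}

def retStep (R : Set S.Adr) : Event S → Set S.Adr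
  | .enter .retire _ as _ => R ∪ {as S.retArg}
  | .free a => R \ {a}
  | _ => R

/-- Addresses that are retired after a history. -/
def retiredH (h : List (Event S)) : Set S.Adr := h.foldl retStep ∅

/-- The automaton supports elision of memory reuse. -/
structure Aut.Elision (A : Aut S X Y) : Prop where
  free_other : ∀ h a b, a ≠ b → h ++ [Event.free a] ∈ A.Spec →
    A.Freeable (h ++ [.free a]) b = A.Freeable h b
  rename_other : ∀ h a b c, a ≠ c → c ≠ b → A.Freeable h c = A.Freeable (rename h a b) c
  fresh : ∀ h a b, a ∉ retiredH h → b ∈ freshH h →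
    A.Freeable h a ⊆ A.Freeable (rename h a b) a
  delay : ∀ h a, A.Freeable (h ++ [.free a]) a ⊆ A.Freeable h a

/-- The standing assumptions on SMR automata. -/
structure Aut.Admissible (A : Aut S X Y) : Prop where
  /-- every event can be processed (events that are not drawn are self loops) -/
  complete : ∀ φ l e, ∃ l', A.Step φ l e l'
  /-- accepting locations are entered only with a `free` -/
  acc_enter : ∀ φ l e l', A.Step φ l e l' → l ∉ A.acc → l' ∈ A.acc → ∃ a, e = .free a
  /-- accepting locations are not left -/
  acc_stay : ∀ φ l e l', A.Step φ l e l' → l ∈ A.acc → l' ∈ A.acc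
  elision : A.Elision

/-! ### Programs -/

/-- Pointer variables, data variables and angels. -/
structure Vars where
  PV : Type u
  DV : Type u
  AV : Type u

inductive Cond (S : Sig.{u}) (V : Vars.{u}) : Type u
  | eq (p q : V.PV)
  | ne (p q : V.PV)
  | pred (R : List S.Dom → Prop) (us : List V.DV)

inductive Com (S : Sig.{u}) (V : Vars.{u}) : Type u
  /-- `p := q` -/
  | assign (p q : V.PV)
  /-- `p := q.next` -/
  | load (p q : V.PV)
  /-- `p.next := q` -/
  | store (p q : V.PV)
  /-- `u := q.data` -/
  | dload (u : V.DV) (q : V.PV)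
  /-- `p.data := u` -/
  | dstore (p : V.PV) (u : V.DV)
  /-- `u := op(us)` -/
  | dop (u : V.DV) (f : List S.Dom → S.Dom) (us : List V.DV)
  | malloc (p : V.PV)
  | assume (c : Cond S V)
  | beginAtomic
  | endAtomic
  | enter (f : Fn S.F) (ps : Fin (S.ptrAr f) → V.PV) (us : Fin (S.datAr f) → V.DV)
  | exit (f : Fn S.F)
  /-- annotation: allocation of the angel `r` -/
  | angel (r : V.AV)
  /-- annotation `p = q` -/
  | invEq (p q : V.PV)
  /-- annotation `p ∈ r` -/
  | invMem (p : V.PV) (r : V.AV)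
  /-- annotation `active(p)` -/
  | invActP (p : V.PV)
  /-- annotation `active(r)` -/
  | invActR (r : V.AV)

inductive Stmt (S : Sig.{u}) (V : Vars.{u}) : Type u
  | skip
  | com (c : Com S V)
  | seq (s₁ s₂ : Stmt S V)
  | choice (s₁ s₂ : Stmt S V)
  | loop (s : Stmt S V)

/-- The variables of a program: shared and thread-local pointer variables, data variables, angels;
data variables and angels are thread-local. -/
structure PVars where
  SV : Type u
  LV : Type u
  DV : Type u
  AV : Type u

/-- The variables in the program text. -/
abbrev PVars.src (W : PVars.{u}) : Vars.{u} := ⟨W.SV ⊕ W.LV, W.DV, W.AV⟩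

/-- The variables at runtime: local variables are indexed by threads. -/
abbrev PVars.rt (W : PVars.{u}) (S : Sig.{u}) : Vars.{u} :=
  ⟨W.SV ⊕ (S.Thread × W.LV), S.Thread × W.DV, S.Thread × W.AV⟩

/-- Renaming of variables. -/
structure VMap (V V' : Vars.{u}) where
  p : V.PV → V'.PV
  d : V.DV → V'.DV
  a : V.AV → V'.AV

variable {V V' : Vars.{u}}

def Cond.map (f : VMap V V') : Cond S V → Cond S V'
  | .eq p q => .eq (f.p p) (f.p q)
  | .ne p q => .ne (f.p p) (f.p q)
  | .pred R us => .pred R (us.map f.d)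

def Com.map (f : VMap V V') : Com S V → Com S V'
  | .assign p q => .assign (f.p p) (f.p q)
  | .load p q => .load (f.p p) (f.p q)
  | .store p q => .store (f.p p) (f.p q)
  | .dload u q => .dload (f.d u) (f.p q)
  | .dstore p u => .dstore (f.p p) (f.d u)
  | .dop u g us => .dop (f.d u) g (us.map f.d)
  | .malloc p => .malloc (f.p p)
  | .assume c => .assume (c.map f)
  | .beginAtomic => .beginAtomic
  | .endAtomic => .endAtomic
  | .enter g ps us => .enter g (fun i => f.p (ps i)) (fun i => f.d (us i))
  | .exit g => .exit g
  | .angel r => .angel (f.a r)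
  | .invEq p q => .invEq (f.p p) (f.p q)
  | .invMem p r => .invMem (f.p p) (f.a r)
  | .invActP p => .invActP (f.p p)
  | .invActR r => .invActR (f.a r)

def Stmt.map (f : VMap V V') : Stmt S V → Stmt S V'
  | .skip => .skip
  | .com c => .com (c.map f)
  | .seq s₁ s₂ => .seq (s₁.map f) (s₂.map f)
  | .choice s₁ s₂ => .choice (s₁.map f) (s₂.map f)
  | .loop s => .loop (s.map f)

/-- Indexing of the local variables by a thread. -/
def PVars.index (W : PVars.{u}) (t : S.Thread) : VMap W.src (W.rt S) where
  p := Sum.map id (fun x => (t, x))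
  d := fun x => (t, x)
  a := fun x => (t, x)

/-! ### Memory and computations -/

/-- The memory.  Pointers evaluate to `some a` for an address `a`, or to `none` for the undefined
pointer `seg`.  All variables are in the domain; the selectors `a.next` and `a.data` of an address
need not be (outer `none`). -/
structure Mem (S : Sig.{u}) (V : Vars.{u}) where
  pvar : V.PV → Option S.Adr
  psel : S.Adr → Option (Option S.Adr)
  dvar : V.DV → S.Dom
  dsel : S.Adr → Option S.Dom

/-- The initial memory. -/
def Mem.initial (S : Sig.{u}) (V : Vars.{u}) : Mem S V where
  pvar := fun _ => none
  psel := fun _ => none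
  dvar := fun _ => S.zero
  dsel := fun _ => none

inductive Upd (S : Sig.{u}) (V : Vars.{u}) : Type u
  | pvar (p : V.PV) (v : Option S.Adr)
  | psel (a : S.Adr) (v : Option S.Adr)
  | dvar (u : V.DV) (d : S.Dom)
  | dsel (a : S.Adr) (d : S.Dom)

open Classical in
noncomputable def Mem.upd (m : Mem S V) : Upd S V → Mem S V
  | .pvar p v => { m with pvar := Function.update m.pvar p v }
  | .psel a v => { m with psel := Function.update m.psel a (some v) }
  | .dvar u d => { m with dvar := Function.update m.dvar u d }
  | .dsel a d => { m with dsel := Function.update m.dsel a (some d) }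

/-- Actions: thread `t` executes a command with a list of updates, or the environment frees an
address. -/
inductive Act (S : Sig.{u}) (V : Vars.{u}) : Type u
  | exec (t : S.Thread) (c : Com S V) (up : List (Upd S V))
  | free (a : S.Adr)

/-- Computations, with the NEWEST action first: `act :: τ` is the computation `τ` followed by
`act`. -/
abbrev Comp (S : Sig.{u}) (V : Vars.{u}) := List (Act S V)

/-- The memory after a computation. -/
noncomputable def heap : Comp S V → Mem S V
  | [] => Mem.initial S V
  | .exec _ _ up :: τ => up.foldl Mem.upd (heap τ)
  | .free _ :: τ => heap τ

/-- The addresses that have never been allocated. -/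
noncomputable def fresh : Comp S V → Set S.Adr
  | [] => Set.univ
  | .free a :: τ => fresh τ \ {a}
  | .exec t (.malloc p) up :: τ =>
      fresh τ \ {a | (heap (.exec t (.malloc p) up :: τ)).pvar p = some a}
  | _ :: τ => fresh τ

/-- The addresses that have been freed since their last allocation. -/
noncomputable def freed : Comp S V → Set S.Adr
  | [] => ∅
  | .free a :: τ => freed τ ∪ {a}
  | .exec t (.malloc p) up :: τ =>
      freed τ \ {a | (heap (.exec t (.malloc p) up :: τ)).pvar p = some a}
  | _ :: τ => freed τ

/-- The addresses that have been retired since their last free. -/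
noncomputable def retired : Comp S V → Set S.Adr
  | [] => ∅
  | .free a :: τ => retired τ \ {a}
  | .exec _ (.enter .retire ps _) _ :: τ => retired τ ∪ {a | (heap τ).pvar (ps S.retArg) = some a}
  | _ :: τ => retired τ

/-- The addresses that are neither freed nor retired. -/
noncomputable def active (τ : Comp S V) : Set S.Adr := (freed τ ∪ retired τ)ᶜ

/-- Pointer expressions: variables `p` and selectors `a.next`. -/
inductive PExp (S : Sig.{u}) (V : Vars.{u}) : Type u
  | var (p : V.PV)
  | sel (a : S.Adr)

/-- The value of a pointer expression; the outer `none` is "not in the domain". -/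
def Mem.pexp (m : Mem S V) : PExp S V → Option (Option S.Adr)
  | .var p => some (m.pvar p)
  | .sel a => m.psel a

open Classical in
/-- The valid pointer expressions after a computation. -/
noncomputable def valid : Comp S V → Set (PExp S V)
  | [] => Set.range PExp.var
  | .exec _ (.assign p q) _ :: τ =>
      if .var q ∈ valid τ then valid τ ∪ {.var p} else valid τ \ {.var p}
  | .exec _ (.store p q) _ :: τ =>
      match (heap τ).pvar p with
      | some a => if .var q ∈ valid τ then valid τ ∪ {.sel a} else valid τ \ {.sel a}
      | none => valid τ
  | .exec _ (.load p q) _ :: τ =>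
      match (heap τ).pvar q with
      | some a => if .sel a ∈ valid τ then valid τ ∪ {.var p} else valid τ \ {.var p}
      | none => valid τ
  | .free a :: τ => valid τ \ ({e | (heap τ).pexp e = some (some a)} ∪ {.sel a})
  | .exec _ (.malloc p) up :: τ =>
      valid τ ∪ {e | ∃ a, Upd.pvar p (some a) ∈ up ∧ (e = .var p ∨ e = .sel a)}
  | .exec _ (.assume (.eq p q)) _ :: τ =>
      if .var p ∈ valid τ ∨ .var q ∈ valid τ then valid τ ∪ {.var p, .var q} else valid τ
  | _ :: τ => valid τ

/-- The event emitted when thread `t` executes a command under the memory `m`, if any. -/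
def Com.event? (m : Mem S V) (t : S.Thread) : Com S V → Option (Event S)
  | .enter f ps us =>
      if h : ∀ i, (m.pvar (ps i)).isSome then
        some (.enter f t (fun i => (m.pvar (ps i)).get (h i)) (fun j => m.dvar (us j)))
      else none
  | .exit f => some (.exit f t)
  | _ => none

/-- The history of a computation (in chronological order). -/
noncomputable def history : Comp S V → List (Event S)
  | [] => []
  | .free a :: τ => history τ ++ [.free a]
  | .exec t c _ :: τ => history τ ++ (c.event? (heap τ) t).toList

/-! ### Semantics -/

def Mem.holds (m : Mem S V) : Cond S V → Prop
  | .eq p q => m.pvar p = m.pvar q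
  | .ne p q => m.pvar p ≠ m.pvar q
  | .pred R us => R (us.map m.dvar)

/-- The conditions on memory and updates under which an action may be appended to `τ`, where the
addresses in `Y` may be reallocated and those in `Z` may be freed. -/
def Enabled (Z Y : Set S.Adr) (τ : Comp S V) : Act S V → Prop
  | .free a => a ∈ Z
  | .exec _ (.assign p q) up => up = [.pvar p ((heap τ).pvar q)]
  | .exec _ (.load p q) up => ∃ a v, (heap τ).pvar q = some a ∧ (heap τ).psel a = some v ∧
      up = [.pvar p v]
  | .exec _ (.store p q) up => ∃ a, (heap τ).pvar p = some a ∧ up = [.psel a ((heap τ).pvar q)]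
  | .exec _ (.dload x q) up => ∃ a d, (heap τ).pvar q = some a ∧ (heap τ).dsel a = some d ∧
      up = [.dvar x d]
  | .exec _ (.dstore p x) up => ∃ a, (heap τ).pvar p = some a ∧ up = [.dsel a ((heap τ).dvar x)]
  | .exec _ (.dop x f xs) up => up = [.dvar x (f (xs.map (heap τ).dvar))]
  | .exec _ (.malloc p) up => ∃ a d, (a ∈ fresh τ ∨ a ∈ freed τ ∩ Y) ∧
      up = [.pvar p (some a), .psel a none, .dsel a d]
  | .exec _ (.assume c) up => (heap τ).holds c ∧ up = []
  | .exec _ (.enter _ ps _) up => (∀ i, (heap τ).pvar (ps i) ≠ none) ∧ up = []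
  | .exec _ _ up => up = []

/-- Small steps of a statement of thread `t`, with the list of emitted actions (at most one).  A
command may be executed with any update here; the update is constrained by `Enabled`. -/
inductive SStep (t : S.Thread) : Stmt S V → List (Act S V) → Stmt S V → Prop
  | com (c : Com S V) (up : List (Upd S V)) : SStep t (.com c) [.exec t c up] .skip
  | skip (s : Stmt S V) : SStep t (.seq .skip s) [] s
  | left (s₁ s₂ : Stmt S V) : SStep t (.choice s₁ s₂) [] s₁
  | right (s₁ s₂ : Stmt S V) : SStep t (.choice s₁ s₂) [] s₂
  | seq (s₁ s₁' s₂ : Stmt S V) (o : List (Act S V)) : s₁ ≠ .skip → SStep t s₁ o s₁' →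
      SStep t (.seq s₁ s₂) o (.seq s₁' s₂)
  | loopStop (s : Stmt S V) : SStep t (.loop s) [] .skip
  | loopLast (s : Stmt S V) : SStep t (.loop s) [] s
  | loopMore (s : Stmt S V) : SStep t (.loop s) [] (.seq s (.loop s))

/-- The threads inside an atomic block. -/
def lockset : Comp S V → Set S.Thread
  | [] => ∅
  | .exec t .beginAtomic _ :: τ => lockset τ ∪ {t}
  | .exec t .endAtomic _ :: τ => lockset τ \ {t}
  | _ :: τ => lockset τ

abbrev PC (S : Sig.{u}) (V : Vars.{u}) := S.Thread → Stmt S V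

open Classical in
/-- Steps of configurations.  Commands are executed inside atomic blocks, and a thread inside an
atomic block is interrupted neither by other threads nor by a `free`. -/
inductive CStep : PC S V × Comp S V → PC S V × Comp S V → Prop
  | inside (pc : PC S V) (τ : Comp S V) (t : S.Thread) (o : List (Act S V)) (s : Stmt S V) :
      SStep t (pc t) o s → lockset τ = {t} → CStep (pc, τ) (Function.update pc t s, o ++ τ)
  | silent (pc : PC S V) (τ : Comp S V) (t : S.Thread) (s : Stmt S V) :
      SStep t (pc t) [] s → lockset τ = ∅ → CStep (pc, τ) (Function.update pc t s, τ)
  | start (pc : PC S V) (τ : Comp S V) (t : S.Thread) (o : List (Act S V)) (s : Stmt S V) :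
      SStep t (pc t) o s → lockset τ = ∅ → lockset (o ++ τ) = {t} →
      CStep (pc, τ) (Function.update pc t s, o ++ τ)
  | free (pc : PC S V) (τ : Comp S V) (a : S.Adr) :
      lockset τ = ∅ → CStep (pc, τ) (pc, .free a :: τ)

variable {W : PVars.{u}}

/-- The control configurations reached by a computation; every thread executes the program, with
its own copies of the local variables. -/
def control (P : Stmt S W.src) (τ : Comp S (W.rt S)) : Set (PC S (W.rt S)) :=
  {pc | Relation.ReflTransGen CStep (fun t => P.map (W.index t), []) (pc, τ)}

/-- The liberal semantics, where `Z` may be freed and `Y` may be reallocated. -/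
def Liberal (P : Stmt S W.src) (Z Y : Set S.Adr) : Comp S (W.rt S) → Prop
  | [] => True
  | act :: τ => Liberal P Z Y τ ∧ (control P (act :: τ)).Nonempty ∧ Enabled Z Y τ act

/-- The SMR semantics: the computations of the liberal semantics with history in the
specification. -/
def SMRSem (A : Aut S X Y) (P : Stmt S W.src) (Z R : Set S.Adr) : Set (Comp S (W.rt S)) :=
  {τ | Liberal P Z R τ ∧ history τ ∈ A.Spec}

/-- Garbage collection: nothing is freed and nothing is reallocated. -/
def GCSem (P : Stmt S W.src) : Set (Comp S (W.rt S)) := {τ | Liberal P ∅ ∅ τ}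

/-! ### Invariant annotations -/

open Classical in
/-- The formula stating the annotations of a rest computation (in chronological order) after the
computation `σ`, where `ρ` interprets the angels; the allocation of an angel is an existential
quantifier over sets of addresses. -/
def InvFrom (σ : Comp S V) (ρ : V.AV → Set S.Adr) : List (Act S V) → Prop
  | [] => True
  | .exec t (.angel r) up :: τ =>
      ∃ B : Set S.Adr, InvFrom (.exec t (.angel r) up :: σ) (Function.update ρ r B) τ
  | .exec t (.invEq p q) up :: τ =>
      (heap σ).pvar p = (heap σ).pvar q ∧ InvFrom (.exec t (.invEq p q) up :: σ) ρ τ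
  | .exec t (.invMem p r) up :: τ =>
      (∃ a ∈ ρ r, (heap σ).pvar p = some a) ∧ InvFrom (.exec t (.invMem p r) up :: σ) ρ τ
  | .exec t (.invActP p) up :: τ =>
      (∃ a ∈ active σ, (heap σ).pvar p = some a) ∧ InvFrom (.exec t (.invActP p) up :: σ) ρ τ
  | .exec t (.invActR r) up :: τ =>
      ρ r ⊆ active σ ∧ InvFrom (.exec t (.invActR r) up :: σ) ρ τ
  | act :: τ => InvFrom (act :: σ) ρ τ

/-- The annotations hold for `τ`: the formula is valid (it is closed, so that `ρ` does not matter,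
if every angel is allocated before it is used). -/
def InvHolds (τ : Comp S V) : Prop := ∀ ρ, InvFrom [] ρ τ.reverse

/-! ### Pointer races -/

/-- The pointer variables that a command dereferences. -/
def Com.derefs : Com S V → Set V.PV
  | .load _ q => {q}
  | .store p _ => {p}
  | .dload _ q => {q}
  | .dstore p _ => {p}
  | _ => ∅

def UnsafeAccess (τ : Comp S V) (act : Act S V) : Prop :=
  ∃ t c up, act = .exec t c up ∧ ∃ p ∈ c.derefs, .var p ∉ valid τ

def UnsafeAssumption (τ : Comp S V) (act : Act S V) : Prop :=
  ∃ t p q up, act = .exec t (.assume (.eq p q)) up ∧ ¬ (.var p ∈ valid τ ∧ .var q ∈ valid τ)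

def UnsafeRetire (τ : Comp S V) (act : Act S V) : Prop :=
  ∃ t ps us up, act = .exec t (.enter .retire ps us) up ∧ .var (ps S.retArg) ∉ valid τ

/-- A call with an invalid argument such that changing the values of invalid arguments may exhibit
new SMR behavior. -/
def UnsafeCall (A : Aut S X Y) (τ : Comp S V) (act : Act S V) : Prop :=
  ∃ t f ps us up, act = .exec t (.enter f ps us) up ∧ (∃ i, .var (ps i) ∉ valid τ) ∧
    ∃ as : Fin (S.ptrAr f) → S.Adr, (∀ i, (heap τ).pvar (ps i) = some (as i)) ∧
    ∃ (c : S.Adr) (bs : Fin (S.ptrAr f) → S.Adr),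
      (∀ i, (as i = c ∨ .var (ps i) ∈ valid τ) → as i = bs i) ∧
      ¬ A.Freeable (history τ ++ [.enter f t bs (fun j => (heap τ).dvar (us j))]) c ⊆
        A.Freeable (history τ ++ [.enter f t as (fun j => (heap τ).dvar (us j))]) c

/-- `τ` followed by `act` raises a pointer race. -/
def RaisesRace (A : Aut S X Y) (τ : Comp S V) (act : Act S V) : Prop :=
  UnsafeAccess τ act ∨ UnsafeAssumption τ act ∨ UnsafeCall A τ act ∨ UnsafeRetire τ act

/-- No initial part of the computation raises a pointer race. -/
def RaceFree (A : Aut S X Y) : Comp S V → Prop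
  | [] => True
  | act :: τ => RaceFree A τ ∧ ¬ RaisesRace A τ act

/-! ### Types -/

/-- No SMR command of a thread other than `z_t` can leave `L`. -/
def Aut.Closed (A : Aut S X Y) (L : Set A.Loc) : Prop :=
  (∀ f l g l', (l, g, l') ∈ A.trans (.enter f) → l ∈ L → l' ∉ L →
    ∀ (φ : Valu S X Y) t as ds, g.eval φ (Event.enter f t as ds).params → t = φ.thr .zt) ∧
  (∀ f l g l', (l, g, l') ∈ A.trans (.exit f) → l ∈ L → l' ∉ L →
    ∀ (φ : Valu S X Y) t, g.eval φ (Event.exit f t).params → t = φ.thr .zt)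

/-- No transition (with a satisfiable guard) frees `z_a` from `L` without reaching an accepting
location. -/
def Aut.NoFree (A : Aut S X Y) (L : Set A.Loc) : Prop :=
  ∀ l g l', (l, g, l') ∈ A.trans .free → l ∈ L → l' ∉ A.acc →
    (∃ (φ : Valu S X Y) (a : S.Adr), g.eval φ (Event.free a).params) →
    ¬ ∀ (φ : Valu S X Y) (a : S.Adr), g.eval φ (Event.free a).params → a = φ.adr .za

/-- The largest set of locations that is closed and from which `z_a` cannot be freed. -/
def Aut.safeLoc (A : Aut S X Y) : Set A.Loc := ⋃₀ {L | A.Closed L ∧ A.NoFree L}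

theorem Aut.safeLoc_isGreatest (A : Aut S X Y) :
    IsGreatest {L | A.Closed L ∧ A.NoFree L} A.safeLoc := by
  refine ⟨⟨⟨?_, ?_⟩, ?_⟩, fun L hL => Set.subset_sUnion_of_mem hL⟩
  · rintro f l g l' ht ⟨L, hL, hl⟩ hl'
    exact hL.1.1 f l g l' ht hl fun h => hl' ⟨L, hL, h⟩
  · rintro f l g l' ht ⟨L, hL, hl⟩ hl'
    exact hL.1.2 f l g l' ht hl fun h => hl' ⟨L, hL, h⟩
  · rintro l g l' ht ⟨L, hL, hl⟩ hl'
    exact hL.2 l g l' ht hl hl'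

/-- The guarantees, relative to the product of the base automaton with `B`: local, active, safe, and
the SMR-specific ones for closed sets of locations. -/
inductive Guar (B : Aut S X Y) : Type
  | lcl
  | actv
  | safe
  | custom (L : Set B.full.Loc) (hL : B.full.Closed L)

/-- Intersection types, as sets of guarantees. -/
abbrev Ty (B : Aut S X Y) := Set (Guar B)

variable {B : Aut S X Y}

def isValid (T : Ty B) : Prop := (T ∩ {.safe, .lcl, .actv}).Nonempty

def Guar.locs : Guar B → Set B.full.Loc
  | .lcl => {l | l.1 = BaseLoc.init}
  | .actv => {l | l.1 = BaseLoc.init}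
  | .safe => B.full.safeLoc
  | .custom L _ => L

/-- The locations of a type; all locations for the empty type. -/
def locsOf (T : Ty B) : Set B.full.Loc := ⋂ g ∈ T, g.locs

/-- The post image of a set of locations under a command, for a pointer or an angel: `z_t` is the
executing thread, and `z_a` is the value of the pointer. -/
def post (A : Aut S X Y) (x : V.PV ⊕ V.AV) (c : Com S V) (L : Set A.Loc) : Set A.Loc :=
  {l' | ∃ (l : A.Loc) (φ : Valu S X Y) (m : Mem S V) (t : S.Thread) (e : Event S),
    c.event? m t = some e ∧ A.Step φ l e l' ∧ l ∈ L ∧ φ.thr .zt = t ∧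
    ∀ p, x = .inl p → m.pvar p = some (φ.adr .za)}

/-- Type environments, total on pointers and angels. -/
abbrev Env (B : Aut S X Y) (V : Vars.{u}) := V.PV ⊕ V.AV → Ty B

/-- The type transformer relation, where `L'` is the post image of the locations of `T`. -/
def Trans (T : Ty B) (L' : Set B.full.Loc) (T' : Ty B) : Prop :=
  L' ⊆ locsOf T' ∧ (isValid T' → isValid T) ∧ {.lcl, .actv} ∩ T' ⊆ {.lcl, .actv} ∩ T

/-- The type transformer relation for a command, on all pointers and angels. -/
def CheckCom (Γ : Env B V) (c : Com S V) (Γ' : Env B V) : Prop :=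
  ∀ x, Trans (Γ x) (post B.full x c (locsOf (Γ x))) (Γ' x)

/-- The type transformer relation without a command, on all pointers and angels. -/
def CheckEps (Γ Γ' : Env B V) : Prop := ∀ x, Trans (Γ x) (locsOf (Γ x)) (Γ' x)

/-- A call is free from pointer races, judged by the types of its pointer arguments. -/
def SafeCall (Γ : Env B V) (f : Fn S.F) (ps : Fin (S.ptrAr f) → V.PV) : Prop :=
  ∀ (h : List (Event S)) (t : S.Thread) (as bs : Fin (S.ptrAr f) → S.Adr) (c : S.Adr)
    (ds : Fin (S.datAr f) → S.Dom),
    (∀ i, (as i = c ∨ isValid (Γ (.inl (ps i)))) → as i = bs i) →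
    B.full.Freeable (h ++ [.enter f t bs ds]) c ⊆ B.full.Freeable (h ++ [.enter f t as ds]) c

open Classical in
/-- Removal of the guarantees that are not stable under interference. -/
noncomputable def rmTransient (Γ : Env B W.src) : Env B W.src
  | .inl (.inl _) => ∅
  | .inl (.inr p) => Γ (.inl (.inr p)) \ {.actv}
  | .inr r => Γ (.inr r) \ {.actv}

open Classical in
/-- Change of the type of one pointer or angel. -/
noncomputable def Env.set (Γ : Env B V) (x : V.PV ⊕ V.AV) (T : Ty B) : Env B V :=
  Function.update Γ x T

/-- Type rules for primitive commands. -/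
inductive TypeCom : Env B W.src → Com S W.src → Env B W.src → Prop
  | assign1 (Γ : Env B W.src) (p q : W.src.PV) :
      TypeCom Γ (.assign p q)
        ((Γ.set (.inl q) (Γ (.inl q) \ {.lcl})).set (.inl p) (Γ (.inl q) \ {.lcl}))
  | assign2 (Γ : Env B W.src) (p q : W.src.PV) : isValid (Γ (.inl q)) →
      TypeCom Γ (.load p q) (Γ.set (.inl p) ∅)
  | assign3 (Γ : Env B W.src) (p q : W.src.PV) : isValid (Γ (.inl p)) →
      TypeCom Γ (.store p q) (Γ.set (.inl q) (Γ (.inl q) \ {.lcl}))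
  | assign4 (Γ : Env B W.src) (x : W.src.DV) (f : List S.Dom → S.Dom) (xs : List W.src.DV) :
      TypeCom Γ (.dop x f xs) Γ
  | assign5 (Γ : Env B W.src) (x : W.src.DV) (q : W.src.PV) : isValid (Γ (.inl q)) →
      TypeCom Γ (.dload x q) Γ
  | assign6 (Γ : Env B W.src) (p : W.src.PV) (x : W.src.DV) : isValid (Γ (.inl p)) →
      TypeCom Γ (.dstore p x) Γ
  | malloc (Γ : Env B W.src) (p : W.LV) :
      TypeCom Γ (.malloc (.inr p)) (Γ.set (.inl (.inr p)) {.lcl})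
  | assume1 (Γ : Env B W.src) (p q : W.src.PV) (T : Ty B) :
      isValid (Γ (.inl p)) → isValid (Γ (.inl q)) →
      T = (Γ (.inl p) ∪ Γ (.inl q)) \ {.lcl} →
      TypeCom Γ (.assume (.eq p q)) ((Γ.set (.inl p) T).set (.inl q) T)
  | assume2 (Γ : Env B W.src) (c : Cond S W.src) : (∀ p q, c ≠ .eq p q) →
      TypeCom Γ (.assume c) Γ
  | equal (Γ : Env B W.src) (p q : W.src.PV) (T : Ty B) : T = Γ (.inl p) ∪ Γ (.inl q) →
      TypeCom Γ (.invEq p q) ((Γ.set (.inl p) T).set (.inl q) T)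
  | activeP (Γ : Env B W.src) (p : W.src.PV) :
      TypeCom Γ (.invActP p) (Γ.set (.inl p) (Γ (.inl p) ∪ {.actv}))
  | activeR (Γ : Env B W.src) (r : W.src.AV) :
      TypeCom Γ (.invActR r) (Γ.set (.inr r) (Γ (.inr r) ∪ {.actv}))
  | angel (Γ : Env B W.src) (r : W.src.AV) : TypeCom Γ (.angel r) (Γ.set (.inr r) ∅)
  | member (Γ : Env B W.src) (p : W.src.PV) (r : W.src.AV) :
      TypeCom Γ (.invMem p r) (Γ.set (.inl p) (Γ (.inl p) ∪ Γ (.inr r)))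
  | enter (Γ Γ' : Env B W.src) (f : Fn S.F) (ps : Fin (S.ptrAr f) → W.src.PV)
      (us : Fin (S.datAr f) → W.src.DV) :
      SafeCall Γ f ps → CheckCom Γ (.enter f ps us) Γ' →
      (f = .retire → ∀ i, .actv ∈ Γ (.inl (ps i))) →
      TypeCom Γ (.enter f ps us) Γ'
  | exit (Γ Γ' : Env B W.src) (f : Fn S.F) : CheckCom Γ (.exit f) Γ' → TypeCom Γ (.exit f) Γ'

/-- Type rules for statements. -/
inductive TypeStmt : Env B W.src → Stmt S W.src → Env B W.src → Prop
  | com (Γ Γ' : Env B W.src) (c : Com S W.src) : TypeCom Γ c Γ' → TypeStmt Γ (.com c) Γ'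
  | skip (Γ : Env B W.src) : TypeStmt Γ .skip Γ
  | infer (Γ₁ Γ₂ Γ₃ Γ₄ : Env B W.src) (s : Stmt S W.src) :
      CheckEps Γ₁ Γ₂ → TypeStmt Γ₂ s Γ₃ → CheckEps Γ₃ Γ₄ → TypeStmt Γ₁ s Γ₄
  | beginA (Γ : Env B W.src) : TypeStmt Γ (.com .beginAtomic) Γ
  | endA (Γ : Env B W.src) : TypeStmt Γ (.com .endAtomic) (rmTransient Γ)
  | seq (Γ Γ' Γ'' : Env B W.src) (s₁ s₂ : Stmt S W.src) :
      TypeStmt Γ s₁ Γ' → TypeStmt Γ' s₂ Γ'' → TypeStmt Γ (.seq s₁ s₂) Γ''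
  | choice (Γ Γ' : Env B W.src) (s₁ s₂ : Stmt S W.src) :
      TypeStmt Γ s₁ Γ' → TypeStmt Γ s₂ Γ' → TypeStmt Γ (.choice s₁ s₂) Γ'
  | loop (Γ : Env B W.src) (s : Stmt S W.src) : TypeStmt Γ s Γ → TypeStmt Γ (.loop s) Γ

/-- The program type checks: it is typable from the environment that assigns the empty type to
every pointer and angel. -/
def TypeChecks (B : Aut S X Y) (P : Stmt S W.src) : Prop :=
  ∃ Γ, TypeStmt (B := B) (fun _ => ∅) P Γ

end SMR

namespace SMR

variable {S : Sig.{u}} {X Y : Type} {V : Vars.{u}} {W : PVars.{u}}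

/-! ### Runs of SMR automata -/

theorem Aut.run_append {A : Aut S X Y} {φ : Valu S X Y} {h h' : List (Event S)} {l l' : A.Loc} :
    A.Run φ l (h ++ h') l' ↔ ∃ l₁, A.Run φ l h l₁ ∧ A.Run φ l₁ h' l' := by
  induction h generalizing l with
  | nil => simp [Aut.Run]
  | cons e h ih =>
    simp only [List.cons_append, Aut.Run, ih]
    constructor
    · rintro ⟨l₁, h₁, l₂, h₂, h₃⟩; exact ⟨l₂, ⟨l₁, h₁, h₂⟩, h₃⟩
    · rintro ⟨l₂, ⟨l₁, h₁, h₂⟩, h₃⟩; exact ⟨l₁, h₁, l₂, h₂, h₃⟩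

theorem Aut.run_singleton {A : Aut S X Y} {φ : Valu S X Y} {e : Event S} {l l' : A.Loc} :
    A.Run φ l [e] l' ↔ A.Step φ l e l' := by
  simp [Aut.Run]

theorem Aut.Admissible.exists_run {A : Aut S X Y} (hA : A.Admissible) (φ : Valu S X Y)
    (l : A.Loc) (h : List (Event S)) : ∃ l', A.Run φ l h l' := by
  induction h generalizing l with
  | nil => exact ⟨l, rfl⟩
  | cons e h ih =>
    obtain ⟨l₁, h₁⟩ := hA.complete φ l e
    obtain ⟨l₂, h₂⟩ := ih l₁
    exact ⟨l₂, l₁, h₁, h₂⟩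

theorem Aut.Admissible.acc_of_run {A : Aut S X Y} (hA : A.Admissible) {φ : Valu S X Y}
    {l l' : A.Loc} {h : List (Event S)} (hr : A.Run φ l h l') (hl : l ∈ A.acc) : l' ∈ A.acc := by
  induction h generalizing l with
  | nil => cases hr; exact hl
  | cons e h ih =>
    obtain ⟨l₁, h₁, h₂⟩ := hr
    exact ih h₂ (hA.acc_stay _ _ _ _ h₁ hl)

/-- By completeness a run over `h` into an accepting location extends over `h'`, and accepting
locations are never left. -/
theorem Aut.Admissible.spec_prefix {A : Aut S X Y} (hA : A.Admissible) {h h' : List (Event S)}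
    (hs : h ++ h' ∈ A.Spec) : h ∈ A.Spec := by
  intro φ l hr hl
  obtain ⟨l', hr'⟩ := hA.exists_run φ l h'
  exact hs φ l' (Aut.run_append.2 ⟨l, hr, hr'⟩) (hA.acc_of_run hr' hl)

/-- Freeability is a congruence for events other than `free`. -/
theorem Aut.freeable_append {A : Aut S X Y} {h k : List (Event S)} {a : S.Adr}
    (hk : A.Freeable h a = A.Freeable k a) (w : List (Event S)) (hw : ∀ b, Event.free b ∉ w) :
    A.Freeable (h ++ w) a = A.Freeable (k ++ w) a := by
  ext h'
  -- Continuing `h ++ w` by `h'` is continuing `h` by `w ++ h'`, and `w` adds no `free` to the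
  -- continuation.
  have := Set.ext_iff.1 hk (w ++ h')
  simp only [Aut.Freeable, Set.mem_ofPred_eq, List.append_assoc, List.mem_append] at this ⊢
  constructor
  · rintro ⟨h₁, h₂⟩
    exact ⟨(this.1 ⟨h₁, fun b hb => h₂ b (hb.resolve_left (hw b))⟩).1, h₂⟩
  · rintro ⟨h₁, h₂⟩
    exact ⟨(this.2 ⟨h₁, fun b hb => h₂ b (hb.resolve_left (hw b))⟩).1, h₂⟩

theorem Aut.step_base {B : Aut S X Y} {φ : Valu S X Y} {l l' : B.full.Loc} {e : Event S}
    (h : B.full.Step φ l e l') : (base S X Y).Step φ l.1 e l'.1 := by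
  obtain ⟨g, ⟨x, hx, y, hy, heq⟩, hg⟩ := h
  cases heq
  exact ⟨x.2.1, hx, hg.1⟩

theorem base_step_free {φ : Valu S X Y} {l : BaseLoc}
    (h : (base S X Y).Step φ .init (.free (φ.adr .za)) l) : l = .final := by
  obtain ⟨g, hg, hv⟩ := h
  rcases hg with h | h | h | h | h <;> cases h
  · rfl
  · simp [Guard.eval, freeZa, Term.eval, Event.params] at hv

theorem base_step_init {φ : Valu S X Y} {l : BaseLoc} {e : Event S}
    (h : (base S X Y).Step φ .init e l) (hf : ∀ a, e ≠ .free a)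
    (hr : ∀ t as ds, e = .enter .retire t as ds → as S.retArg ≠ φ.adr .za) : l = .init := by
  obtain ⟨g, hg, hv⟩ := h
  rcases e with a | ⟨_ | f, t, as, ds⟩ | ⟨f, t⟩
  · exact absurd rfl (hf a)
  · rcases hg with h | h | h | h <;> cases h
    · exact absurd hv (hr t as ds rfl)
    · rfl
  all_goals
    rcases hg with h | h | h <;> cases h
    rfl

/-- The address `z_a` cannot be freed from a location that is safe or in which it is active. -/
theorem Aut.Admissible.acc_of_free {B : Aut S X Y} (hB : B.full.Admissible) {φ : Valu S X Y}
    {l l' : B.full.Loc} (h : B.full.Step φ l (.free (φ.adr .za)) l')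
    (hl : l.1 = .init ∨ l ∈ B.full.safeLoc) : l' ∈ B.full.acc := by
  have hb := B.step_base h
  rcases hl with hl | hl
  · rw [hl] at hb
    exact Or.inl (base_step_free hb)
  -- The base location `final` is split off because its self-loop has the guard `tt`, which does not
  -- force the freed address to be `z_a`; `Aut.NoFree` says nothing about such a transition.
  by_cases hfin : l.1 = .final
  · exact hB.acc_stay _ _ _ _ h (Or.inl hfin)
  by_contra hacc
  obtain ⟨g, hg, hv⟩ := h
  refine B.full.safeLoc_isGreatest.1.2 l g l' hg hl hacc ⟨φ, φ.adr .za, hv⟩ ?_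
  obtain ⟨x, hx, y, hy, heq⟩ := hg
  cases heq
  intro ψ a hψ
  have h₁ := hv.1
  have h₂ := hψ.1
  -- Outside `final` the base component of the guard is `freeZa` or its negation. The negation
  -- contradicts the step at hand, and `freeZa` makes the whole guard imply that `z_a` is freed, as
  -- `Aut.NoFree` requires.
  rcases hx with rfl | rfl | rfl | rfl | rfl
  · exact h₂
  · simp [Guard.eval, freeZa, Term.eval, Event.params] at h₁
  · exact h₂
  · simp [Guard.eval, freeZa, Term.eval, Event.params] at h₁
  · exact absurd rfl hfin

/-! ### Elimination of the frees of a computation -/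

/-- The computation without its `free` actions. -/
def elide : Comp S V → Comp S V
  | [] => []
  | .free _ :: τ => elide τ
  | .exec t c up :: τ => .exec t c up :: elide τ

@[simp] theorem elide_nil : elide ([] : Comp S V) = [] := rfl
@[simp] theorem elide_free (a : S.Adr) (τ : Comp S V) : elide (.free a :: τ) = elide τ := rfl
@[simp] theorem elide_exec (t : S.Thread) (c : Com S V) (up : List (Upd S V)) (τ : Comp S V) :
    elide (.exec t c up :: τ) = .exec t c up :: elide τ := rfl

theorem elide_append (w τ : Comp S V) : elide (w ++ τ) = elide w ++ elide τ := by
  induction w with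
  | nil => rfl
  | cons act w ih => cases act <;> simp [ih]

@[simp] theorem heap_elide (τ : Comp S V) : heap (elide τ) = heap τ := by
  induction τ with
  | nil => rfl
  | cons act τ ih => cases act <;> simp [heap, ih]

theorem history_exec (t : S.Thread) (c : Com S V) (up : List (Upd S V)) (τ : Comp S V) :
    history (.exec t c up :: τ) = history τ ++ (c.event? (heap τ) t).toList := rfl

theorem lockset_elide (τ : Comp S V) : lockset (elide τ) = lockset τ := by
  induction τ with
  | nil => rfl
  | cons act τ ih =>
    rcases act with ⟨t, c, up⟩ | a
    · cases c <;> simp [lockset, ih]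
    · simp [lockset, ih]

/-- A `free` only removes addresses from the fresh ones. This is why `malloc` stays enabled after
elision. -/
theorem fresh_subset_elide (τ : Comp S V) : fresh τ ⊆ fresh (elide τ) := by
  induction τ with
  | nil => exact le_rfl
  | cons act τ ih =>
    rcases act with ⟨t, c, up⟩ | a
    · cases c
      case malloc p =>
        simp only [elide_exec, fresh, heap, heap_elide]
        exact Set.sdiff_subset_sdiff_left ih
      all_goals simpa [fresh] using ih
    · simp only [elide_free, fresh]
      exact Set.sdiff_subset.trans ih

theorem event?_not_free {m : Mem S V} {t : S.Thread} {c : Com S V} (b : S.Adr) :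
    Event.free b ∉ (c.event? m t).toList := by
  cases c <;> simp only [Com.event?, Option.toList_none, Option.toList_some, List.mem_singleton,
    reduceCtorEq, List.not_mem_nil, not_false_eq_true]
  rename_i f ps us
  by_cases h : ∀ i, (m.pvar (ps i)).isSome = true <;> simp [h]

/-- Every action is enabled, where nothing may be reallocated. -/
def EnabledAll : Comp S V → Prop
  | [] => True
  | act :: τ => EnabledAll τ ∧ Enabled Set.univ ∅ τ act

theorem Liberal.enabledAll {P : Stmt S W.src} {τ : Comp S (W.rt S)}
    (h : Liberal P Set.univ ∅ τ) : EnabledAll τ := by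
  induction τ with
  | nil => trivial
  | cons act τ ih => exact ⟨ih h.1, h.2.2⟩

theorem EnabledAll.suffix {w τ : Comp S V} (h : EnabledAll (w ++ τ)) : EnabledAll τ := by
  induction w with
  | nil => exact h
  | cons act w ih => exact ih h.1

theorem Enabled.elide {t : S.Thread} {c : Com S V} {up : List (Upd S V)} {τ : Comp S V}
    (h : Enabled Set.univ ∅ τ (.exec t c up)) : Enabled ∅ ∅ (elide τ) (.exec t c up) := by
  cases c
  case malloc p =>
    obtain ⟨a, d, ha | ha, hu⟩ := h
    · exact ⟨a, d, Or.inl (fresh_subset_elide τ ha), hu⟩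
    · exact absurd ha.2 (Set.notMem_empty a)
  all_goals simpa [Enabled] using h

/-- A `free` turns into no step at all, hence the reflexive closure. All other steps carry over
because threads emit no `free` and the lock does not depend on frees. -/
theorem CStep.elide {pc pc' : PC S V} {τ τ' : Comp S V} (h : CStep (pc, τ) (pc', τ')) :
    Relation.ReflTransGen CStep (pc, elide τ) (pc', elide τ') := by
  have key : ∀ {t : S.Thread} {s s' : Stmt S V} {o : List (Act S V)}, SStep t s o s' →
      SMR.elide o = o := by
    intro t s s' o ho
    induction ho <;> first | rfl | assumption
  cases h with
  | inside _ _ t o s hs hl =>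
    rw [elide_append, key hs]
    exact .single (.inside _ _ _ _ _ hs (by rw [lockset_elide, hl]))
  | silent _ _ t s hs hl => exact .single (.silent _ _ _ _ hs (by rw [lockset_elide, hl]))
  | start _ _ t o s hs hl hl' =>
    have := lockset_elide (o ++ τ)
    rw [elide_append, key hs] at this ⊢
    exact .single (.start _ _ _ _ _ hs (by rw [lockset_elide, hl]) (by rw [this, hl']))
  | free _ _ a hl => exact .refl

theorem control_elide {P : Stmt S W.src} {τ : Comp S (W.rt S)} (h : (control P τ).Nonempty) :
    (control P (elide τ)).Nonempty := by
  obtain ⟨pc, h⟩ := h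
  exact ⟨pc, Relation.ReflTransGen.lift'
    (fun x : PC S (W.rt S) × Comp S (W.rt S) => (x.1, elide x.2))
    (fun _ _ hs => CStep.elide hs) _ _ h⟩

theorem Liberal.elide {P : Stmt S W.src} {τ : Comp S (W.rt S)}
    (h : Liberal P Set.univ ∅ τ) : elide τ ∈ GCSem P := by
  induction τ with
  | nil => trivial
  | cons act τ ih =>
    have := ih h.1
    rcases act with ⟨t, c, up⟩ | a
    · exact ⟨this, control_elide h.2.1, h.2.2.elide⟩
    · exact this

/-! ### Fresh, freed and retired addresses without reallocation -/

/-- Addresses in use are not fresh. -/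
structure AllocInv (τ : Comp S V) : Prop where
  pvar : ∀ x a, (heap τ).pvar x = some a → a ∉ fresh τ
  psel : ∀ b a, (heap τ).psel b = some (some a) → a ∉ fresh τ
  freed : ∀ a ∈ freed τ, a ∉ fresh τ
  retired : ∀ a ∈ retired (elide τ), a ∉ fresh τ

theorem heap_malloc (τ : Comp S V) (t : S.Thread) (p : V.PV) (a : S.Adr) (d : S.Dom) :
    (heap (.exec t (.malloc p) [.pvar p (some a), .psel a none, .dsel a d] :: τ)).pvar p
      = some a := by
  simp [heap, Mem.upd]

/-- Values only enter memory by copying or by `malloc`, and `malloc` removes its address from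
`fresh`. It follows later that an allocated address is held nowhere else and is neither freed nor
retired in the elided computation. -/
theorem EnabledAll.allocInv {τ : Comp S V} (h : EnabledAll τ) : AllocInv τ := by
  classical
  induction τ with
  | nil => constructor <;> simp [heap, Mem.initial, freed, retired]
  | cons act τ ih =>
    obtain ⟨h₁, h₂, h₃, h₄⟩ := ih h.1
    have he := h.2
    rcases act with ⟨t, c, up⟩ | a
    · cases c
      case malloc p =>
        obtain ⟨a, d, ha | ha, rfl⟩ := he
        swap
        · exact absurd ha.2 (Set.notMem_empty a)
        constructor
        · intro x b hx
          simp only [fresh, heap_malloc]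
          simp only [heap, Mem.upd, List.foldl, Function.update_apply] at hx
          split_ifs at hx with hxp
          · simp_all
          · exact fun hb => h₁ x b hx hb.1
        · intro x b hx
          simp only [fresh, heap_malloc]
          simp only [heap, Mem.upd, List.foldl, Function.update_apply] at hx
          split_ifs at hx with hxp
          · simp at hx
          · exact fun hb => h₂ x b hx hb.1
        · intro b hb hb'
          simp only [fresh, SMR.freed] at hb hb'
          exact h₃ b hb.1 hb'.1
        · intro b hb hb'
          simp only [fresh, SMR.retired, elide_exec] at hb hb'
          exact h₄ b hb hb'.1
      case assign p q =>
        cases he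
        refine ⟨fun x b hx => ?_, h₂, h₃, h₄⟩
        simp only [heap, Mem.upd, List.foldl, Function.update_apply] at hx
        split_ifs at hx
        exacts [h₁ _ _ hx, h₁ _ _ hx]
      case load p q =>
        obtain ⟨a, v, hq, hv, rfl⟩ := he
        refine ⟨fun x b hx => ?_, h₂, h₃, h₄⟩
        simp only [heap, Mem.upd, List.foldl, Function.update_apply] at hx
        split_ifs at hx
        exacts [h₂ a b (by rw [hv, hx]), h₁ _ _ hx]
      case store p q =>
        obtain ⟨a, hp, rfl⟩ := he
        refine ⟨h₁, fun x b hx => ?_, h₃, h₄⟩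
        simp only [heap, Mem.upd, List.foldl, Function.update_apply] at hx
        split_ifs at hx
        exacts [h₁ q b (by simpa using hx), h₂ _ _ hx]
      case dload x q =>
        obtain ⟨a, d, hq, hv, rfl⟩ := he
        exact ⟨h₁, h₂, h₃, h₄⟩
      case dstore p x =>
        obtain ⟨a, hq, rfl⟩ := he
        exact ⟨h₁, h₂, h₃, h₄⟩
      case dop =>
        cases he
        exact ⟨h₁, h₂, h₃, h₄⟩
      case assume =>
        obtain ⟨_, rfl⟩ := he
        exact ⟨h₁, h₂, h₃, h₄⟩
      case enter f ps us =>
        obtain ⟨hs, rfl⟩ := he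
        refine ⟨h₁, h₂, h₃, ?_⟩
        rcases f with _ | f
        · intro b hb
          simp only [elide_exec, SMR.retired, heap_elide] at hb
          rcases hb with hb | hb
          exacts [h₄ b hb, h₁ _ b hb]
        · exact h₄
      all_goals
        cases he
        exact ⟨h₁, h₂, h₃, h₄⟩
    · refine ⟨fun x b hx hb => h₁ x b hx hb.1, fun x b hx hb => h₂ x b hx hb.1, ?_,
        fun b hx hb => h₄ b hx hb.1⟩
      rintro b (hb | hb) hb'
      exacts [h₃ b hb hb'.1, hb'.2 hb]

/-- Only `malloc` could take an address out of `freed`, but without reallocation it returns a fresh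
one, which was never freed. -/
theorem freed_exec {t : S.Thread} {c : Com S V} {up : List (Upd S V)} {τ : Comp S V}
    (hτ : EnabledAll τ) (h : Enabled Set.univ ∅ τ (.exec t c up)) :
    freed (.exec t c up :: τ) = freed τ := by
  cases c
  case malloc p =>
    obtain ⟨a, d, ha | ha, rfl⟩ := h
    · simp only [freed, heap_malloc]
      refine sdiff_eq_left.2 (Set.disjoint_left.2 fun b hb hb' => ?_)
      cases hb'
      exact hτ.allocInv.freed a hb ha
    · exact absurd ha.2 (Set.notMem_empty a)
  all_goals rfl

/-- The frees of other addresses do not influence the continuations for an unfreed address. -/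
theorem freeable_elide {A : Aut S X Y} (hA : A.Admissible) {τ : Comp S V} (hτ : EnabledAll τ)
    (hs : history τ ∈ A.Spec) {a : S.Adr} (ha : a ∉ freed τ) :
    A.Freeable (history τ) a = A.Freeable (history (elide τ)) a := by
  induction τ with
  | nil => rfl
  | cons act τ ih =>
    rcases act with ⟨t, c, up⟩ | b
    · rw [freed_exec hτ.1 hτ.2] at ha
      rw [elide_exec, history_exec, history_exec, heap_elide]
      rw [history_exec] at hs
      exact Aut.freeable_append (ih hτ.1 (hA.spec_prefix hs) ha) _ event?_not_free
    · have ha' : a ∉ freed τ ∧ b ≠ a := by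
        simp only [freed, Set.mem_union, Set.mem_singleton_iff, not_or] at ha
        exact ⟨ha.1, Ne.symm ha.2⟩
      have hs' : history τ ++ [.free b] ∈ A.Spec := hs
      -- The freed `b` differs from `a` because `a` is still unfreed afterwards, so the first
      -- elision condition removes this `free`.
      rw [elide_free, ← ih hτ.1 (hA.spec_prefix hs') ha'.1]
      exact hA.elision.free_other _ _ _ ha'.2 hs'

/-- After a history without frees, an address that was not retired is in the initial location of
the base automaton. -/
theorem run_elide_init {B : Aut S X Y} {φ : Valu S X Y} {τ : Comp S V} {l : B.full.Loc}
    (hr : B.full.Run φ B.full.init (history (elide τ)) l)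
    (ha : φ.adr .za ∉ retired (elide τ)) : l.1 = .init := by
  induction τ generalizing l with
  | nil => cases hr; rfl
  | cons act τ ih =>
    rcases act with ⟨t, c, up⟩ | b
    · rw [elide_exec, history_exec, Aut.run_append] at hr
      obtain ⟨l₁, h₁, h₂⟩ := hr
      have hl₁ : l₁.1 = .init := ih h₁ <| by
        refine fun h => ha ?_
        cases c
        case enter f ps us =>
          cases f
          exacts [Or.inl h, h]
        all_goals exact h
      cases hc : c.event? (heap (elide τ)) t with
      | none => rw [hc] at h₂; cases h₂; exact hl₁
      | some e =>
        rw [hc, Option.toList_some, Aut.run_singleton] at h₂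
        have hb := Aut.step_base h₂
        rw [hl₁] at hb
        refine base_step_init hb ?_ ?_
        · rintro a rfl
          exact event?_not_free (m := heap (elide τ)) (t := t) (c := c) a (by rw [hc]; simp)
        · rintro t' as ds rfl hza
          cases c <;> simp only [Com.event?, reduceCtorEq, Option.some.injEq] at hc
          rename_i f ps us
          split_ifs at hc with hsome
          simp only [Option.some.injEq, Event.enter.injEq] at hc
          obtain ⟨rfl, rfl, hc, -⟩ := hc
          refine ha (Or.inr ?_)
          cases hc
          simp only [Set.mem_ofPred_eq, ← hza, Option.some_get]
    · exact ih hr ha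

/-- The continuation `[free a]` is admitted after `history τ`, hence after the elided history by
`freeable_elide`. Extending a run from `init` or a safe location by this event would accept. -/
theorem not_free_of_safe {B : Aut S X Y} (hB : B.full.Admissible) {τ : Comp S V}
    (hτ : EnabledAll τ) {a : S.Adr} (hs : history (.free a :: τ) ∈ B.full.Spec)
    (ha : a ∉ freed τ) {φ : Valu S X Y} (hφ : φ.adr .za = a) {l : B.full.Loc}
    (hr : B.full.Run φ B.full.init (history (elide τ)) l) :
    ¬ (l.1 = .init ∨ l ∈ B.full.safeLoc) := by
  subst hφ
  intro hl
  have hs' : history τ ++ [.free (φ.adr .za)] ∈ B.full.Spec := hs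
  have hf : [Event.free (φ.adr .za)] ∈ B.full.Freeable (history τ) (φ.adr .za) :=
    ⟨hs', by simp⟩
  rw [freeable_elide hB hτ (hB.spec_prefix hs') ha] at hf
  obtain ⟨l', hl'⟩ := hB.complete φ l (.free (φ.adr .za))
  exact hf.1 φ l' (Aut.run_append.2 ⟨l, hr, Aut.run_singleton.2 hl'⟩) (hB.acc_of_free hl' hl)

/-- Only retired addresses are freed. -/
theorem freed_subset_retired {B : Aut S X Y} (hB : B.full.Admissible) [Nonempty S.Thread]
    {τ : Comp S V} (hτ : EnabledAll τ) (hs : history τ ∈ B.full.Spec) :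
    freed τ ⊆ retired (elide τ) := by
  induction τ with
  | nil => exact le_rfl
  | cons act τ ih =>
    rcases act with ⟨t, c, up⟩ | a
    · rw [freed_exec hτ.1 hτ.2]
      refine (ih hτ.1 (hB.spec_prefix hs)).trans ?_
      cases c
      case enter f ps us =>
        cases f
        exacts [Set.subset_union_left, le_rfl]
      all_goals exact le_rfl
    · have hsub := ih hτ.1 (hB.spec_prefix (h' := [.free a]) hs)
      refine Set.union_subset hsub (Set.singleton_subset_iff.2 ?_)
      by_contra ha
      -- Only `z_a = a` matters here: if `a` was never retired, the base automaton is still in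
      -- `init` under this valuation and `a` cannot be freed.
      let φ : Valu S X Y := ⟨fun _ => Classical.arbitrary _, fun _ => a⟩
      obtain ⟨l, hl⟩ := hB.exists_run φ B.full.init (history (elide τ))
      exact not_free_of_safe hB hτ.1 hs (fun h => ha (hsub h)) rfl hl
        (Or.inl (run_elide_init hl ha))

/-- The elements of `freed` are not active in the computation without frees. -/
theorem active_elide_not_freed {B : Aut S X Y} (hB : B.full.Admissible) [Nonempty S.Thread]
    {τ : Comp S V} (hτ : EnabledAll τ) (hs : history τ ∈ B.full.Spec) {a : S.Adr}
    (ha : a ∈ active (elide τ)) : a ∉ freed τ ∧ a ∉ retired (elide τ) := by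
  have h₁ : a ∉ retired (elide τ) := fun h => ha (Or.inr h)
  exact ⟨fun h => h₁ (freed_subset_retired hB hτ hs h), h₁⟩

/-! ### Validity without reallocation -/

/-- A pointer expression is valid unless its value is a freed address. -/
structure ValidInv (τ : Comp S V) : Prop where
  var : ∀ p, .var p ∈ valid τ ↔ ∀ a, (heap τ).pvar p = some a → a ∉ freed τ
  sel : ∀ a v, a ∉ freed τ → (heap τ).psel a = some v →
    (.sel a ∈ valid τ ↔ ∀ b, v = some b → b ∉ freed τ)

theorem ValidInv.nil : ValidInv ([] : Comp S V) := by
  constructor <;> simp [valid, freed, heap, Mem.initial]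

/-- Freeing `a` invalidates `a.next` whatever its value; this is why `ValidInv.sel` is restricted to
selectors of unfreed addresses. -/
theorem ValidInv.free {τ : Comp S V} (h : ValidInv τ) (a : S.Adr) :
    ValidInv (.free a :: τ) := by
  obtain ⟨h₁, h₂⟩ := h
  constructor
  · intro p
    have := h₁ p
    simp only [valid, freed, heap, Mem.pexp, Set.mem_sdiff, Set.mem_union, Set.mem_ofPred_eq,
      Set.mem_singleton_iff, reduceCtorEq, or_false, Option.some.injEq, this]
    grind
  · intro b v hb hv
    simp only [freed, Set.mem_union, Set.mem_singleton_iff, not_or] at hb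
    have hv' : (heap τ).psel b = some v := hv
    have := h₂ b v hb.1 hv'
    simp only [valid, freed, Mem.pexp, Set.mem_sdiff, Set.mem_union, Set.mem_ofPred_eq,
      Set.mem_singleton_iff, PExp.sel.injEq, hb.2, or_false, hv', Option.some.injEq, this]
    grind

/-- Assignments move validity together with the value. A load that is not a race goes through a
valid pointer, so the address read is unfreed and `ValidInv.sel` describes its selector; a load from
a freed address would break the equivalence. -/
theorem ValidInv.exec {t : S.Thread} {c : Com S V} {up : List (Upd S V)} {τ : Comp S V}
    (h : ValidInv τ) (hτ : EnabledAll τ) (he : Enabled Set.univ ∅ τ (.exec t c up))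
    (hr : ¬ UnsafeAccess τ (.exec t c up)) : ValidInv (.exec t c up :: τ) := by
  classical
  have hf := freed_exec hτ he
  have hd : ∀ p ∈ c.derefs, .var p ∈ valid τ := by
    intro p hp
    by_contra hv
    exact hr ⟨t, c, up, rfl, p, hp, hv⟩
  have hal := hτ.allocInv
  obtain ⟨h₁, h₂⟩ := h
  cases c
  case assign p q =>
    cases he
    constructor
    · intro x
      rw [hf]
      simp only [valid, heap, Mem.upd, List.foldl, Function.update_apply]
      by_cases hx : x = p
      · rw [if_pos hx, ← h₁ q]
        split_ifs with hqv <;> simp [hqv, hx]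
      · rw [if_neg hx, ← h₁ x]
        split_ifs <;> simp [hx]
    · intro a v ha hv
      rw [hf] at ha ⊢
      rw [← h₂ a v ha hv]
      simp only [valid]
      split_ifs <;> simp
  case load p q =>
    obtain ⟨a, v, hq, hv, rfl⟩ := he
    have ha := (h₁ q).1 (hd q rfl) a hq
    have hs := h₂ a v ha hv
    constructor
    · intro x
      rw [hf]
      simp only [valid, heap, Mem.upd, List.foldl, Function.update_apply, hq]
      by_cases hx : x = p
      · rw [if_pos hx, ← hs]
        split_ifs with hqv <;> simp [hqv, hx]
      · rw [if_neg hx, ← h₁ x]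
        split_ifs <;> simp [hx]
    · intro a v ha hv
      rw [hf] at ha ⊢
      rw [← h₂ a v ha hv]
      simp only [valid, hq]
      split_ifs <;> simp
  case store p q =>
    obtain ⟨a, hp, rfl⟩ := he
    have ha := (h₁ p).1 (hd p rfl) a hp
    constructor
    · intro x
      rw [hf]
      refine Iff.trans ?_ (h₁ x)
      simp only [valid, hp]
      split_ifs <;> simp
    · intro b v hb hv
      rw [hf] at hb ⊢
      have hq := h₁ q
      simp only [heap, Mem.upd, List.foldl, Function.update_apply] at hv
      simp only [valid, hp]
      by_cases hba : b = a
      · subst hba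
        simp only [if_true, Option.some.injEq] at hv
        subst hv
        rw [← hq]
        split_ifs with hqv <;> simp [hqv]
      · rw [if_neg hba] at hv
        rw [← h₂ b v hb hv]
        split_ifs <;> simp [hba]
  case malloc p =>
    obtain ⟨a, d, ha | ha, rfl⟩ := he
    swap
    · exact absurd ha.2 (Set.notMem_empty a)
    have haf : a ∉ freed τ := fun h => hal.freed a h ha
    constructor
    · intro x
      rw [hf]
      have := h₁ x
      simp only [valid, heap, Mem.upd, List.foldl, Function.update_apply]
      by_cases hx : x = p <;> simp_all
    · intro b v hb hv
      rw [hf] at hb ⊢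
      simp only [heap, Mem.upd, List.foldl, Function.update_apply] at hv
      simp only [valid]
      by_cases hba : b = a
      · subst hba
        simp only [if_true, Option.some.injEq] at hv
        subst hv
        simp
      · rw [if_neg hba] at hv
        rw [← h₂ b v hb hv]
        simp [hba]
  case assume cd =>
    obtain ⟨hc, rfl⟩ := he
    -- A passed equality test compares equal values, which by the invariant are both valid or both
    -- invalid; so it validates nothing new.
    have hva : valid (.exec t (.assume cd) [] :: τ) = valid τ := by
      rcases cd with ⟨p, q⟩ | ⟨p, q⟩ | ⟨R, us⟩ <;> try rfl
      simp only [valid]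
      split_ifs with hpq
      · have hp := h₁ p
        have hq := h₁ q
        rw [show (heap τ).pvar p = (heap τ).pvar q from hc, ← hq] at hp
        rw [hp, or_self] at hpq
        simp [hpq, hp]
      · rfl
    constructor
    · rw [hva, hf]; exact h₁
    · rw [hva, hf]; exact h₂
  case dload x q =>
    obtain ⟨a, d, hq, hv, rfl⟩ := he
    exact ⟨h₁, h₂⟩
  case dstore p x =>
    obtain ⟨a, hq, rfl⟩ := he
    exact ⟨h₁, h₂⟩
  case enter f ps us =>
    obtain ⟨hs, rfl⟩ := he
    exact ⟨h₁, h₂⟩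
  all_goals
    cases he
    exact ⟨h₁, h₂⟩

theorem RaceFree.validInv {A : Aut S X Y} {τ : Comp S V} (hr : RaceFree A τ)
    (hτ : EnabledAll τ) : ValidInv τ := by
  induction τ with
  | nil => exact .nil
  | cons act τ ih =>
    rcases act with ⟨t, c, up⟩ | a
    · exact (ih hr.1 hτ.1).exec hτ.1 hτ.2 fun h => hr.2 (Or.inl h)
    · exact (ih hr.1 hτ.1).free a

/-! ### Effects of single commands -/

/-- The variable that a command writes. -/
def Com.tgt : Com S V → Set V.PV
  | .assign p _ => {p}
  | .load p _ => {p}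
  | .malloc p => {p}
  | _ => ∅

/-- The variable whose value a command copies. -/
def Com.src : Com S V → Set V.PV
  | .assign _ q => {q}
  | .store _ q => {q}
  | _ => ∅

/-- The only pointer expression with value `a` is the variable `x`. -/
def Sole (m : Mem S V) (x : V.PV) (a : S.Adr) : Prop :=
  (∀ y, m.pvar y = some a → y = x) ∧ ∀ b, m.psel b ≠ some (some a)

theorem pvar_exec {t : S.Thread} {c : Com S V} {up : List (Upd S V)} {τ : Comp S V}
    (he : Enabled Set.univ ∅ τ (.exec t c up)) {x : V.PV} (hx : x ∉ c.tgt) :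
    (heap (.exec t c up :: τ)).pvar x = (heap τ).pvar x := by
  classical
  cases c
  case assign p q =>
    cases he
    have hx' : x ≠ p := hx
    simp [heap, Mem.upd, hx']
  case load p q =>
    obtain ⟨a, v, hq, hv, rfl⟩ := he
    have hx' : x ≠ p := hx
    simp [heap, Mem.upd, hx']
  case store => obtain ⟨a, hp, rfl⟩ := he; rfl
  case malloc p =>
    obtain ⟨a, d, -, rfl⟩ := he
    have hx' : x ≠ p := hx
    simp [heap, Mem.upd, hx']
  case dload => obtain ⟨a, d, hq, hv, rfl⟩ := he; rfl
  case dstore => obtain ⟨a, hq, rfl⟩ := he; rfl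
  case enter => obtain ⟨hs, rfl⟩ := he; rfl
  case assume => obtain ⟨hs, rfl⟩ := he; rfl
  all_goals cases he; rfl

/-- A second holder of `a` could arise only by copying `x`, by loading `a` from a selector, or by
allocating `a`. The first is excluded by `hsrc`, the second because no selector contains `a`, and
the third because `a` is in use and thus not fresh. -/
theorem Sole.exec {t : S.Thread} {c : Com S V} {up : List (Upd S V)} {τ : Comp S V}
    (hτ : EnabledAll τ) (he : Enabled Set.univ ∅ τ (.exec t c up)) {x : V.PV} {a : S.Adr}
    (hsrc : x ∉ c.src) (hx : (heap τ).pvar x = some a) (h : Sole (heap τ) x a) :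
    Sole (heap (.exec t c up :: τ)) x a := by
  classical
  have hal := hτ.allocInv
  obtain ⟨h₁, h₂⟩ := h
  cases c
  case assign p q =>
    cases he
    refine ⟨fun y hy => ?_, h₂⟩
    simp only [heap, Mem.upd, List.foldl, Function.update_apply] at hy
    split_ifs at hy
    · exact absurd (h₁ q hy).symm hsrc
    · exact h₁ y hy
  case load p q =>
    obtain ⟨b, v, hq, hv, rfl⟩ := he
    refine ⟨fun y hy => ?_, h₂⟩
    simp only [heap, Mem.upd, List.foldl, Function.update_apply] at hy
    split_ifs at hy
    · exact absurd (by rw [hv, hy]) (h₂ b)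
    · exact h₁ y hy
  case store p q =>
    obtain ⟨b, hp, rfl⟩ := he
    refine ⟨h₁, fun b' hy => ?_⟩
    simp only [heap, Mem.upd, List.foldl, Function.update_apply] at hy
    split_ifs at hy
    · exact absurd (h₁ q (by simpa using hy)).symm hsrc
    · exact h₂ b' hy
  case malloc p =>
    obtain ⟨b, d, hb | hb, rfl⟩ := he
    swap
    · exact absurd hb.2 (Set.notMem_empty b)
    have hba : b ≠ a := by rintro rfl; exact hal.pvar x b hx hb
    constructor
    · intro y hy
      simp only [heap, Mem.upd, List.foldl, Function.update_apply] at hy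
      split_ifs at hy
      · exact absurd (by simpa using hy) hba
      · exact h₁ y hy
    · intro b' hy
      simp only [heap, Mem.upd, List.foldl, Function.update_apply] at hy
      split_ifs at hy
      · simp at hy
      · exact h₂ b' hy
  case dload => obtain ⟨a, d, hq, hv, rfl⟩ := he; exact ⟨h₁, h₂⟩
  case dstore => obtain ⟨a, hq, rfl⟩ := he; exact ⟨h₁, h₂⟩
  case enter => obtain ⟨hs, rfl⟩ := he; exact ⟨h₁, h₂⟩
  case assume => obtain ⟨hs, rfl⟩ := he; exact ⟨h₁, h₂⟩
  all_goals cases he; exact ⟨h₁, h₂⟩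

/-- By `AllocInv` no pointer or selector holds a fresh address before the allocation. -/
theorem sole_malloc {t : S.Thread} {p : V.PV} {up : List (Upd S V)} {τ : Comp S V}
    (hτ : EnabledAll τ) (he : Enabled Set.univ ∅ τ (.exec t (.malloc p) up)) {a : S.Adr}
    (ha : (heap (.exec t (.malloc p) up :: τ)).pvar p = some a) :
    a ∈ fresh τ ∧ Sole (heap (.exec t (.malloc p) up :: τ)) p a := by
  classical
  have hal := hτ.allocInv
  obtain ⟨b, d, hb | hb, rfl⟩ := he
  swap
  · exact absurd hb.2 (Set.notMem_empty b)
  obtain rfl : b = a := by simpa [heap_malloc] using ha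
  refine ⟨hb, fun y hy => ?_, fun b' hy => ?_⟩
  · simp only [heap, Mem.upd, List.foldl, Function.update_apply] at hy
    split_ifs at hy with hyp
    · exact hyp
    · exact absurd hb (hal.pvar y b hy)
  · simp only [heap, Mem.upd, List.foldl, Function.update_apply] at hy
    split_ifs at hy
    · simp at hy
    · exact absurd hb (hal.psel _ b hy)

variable {B : Aut S X Y}

/-! ### Types and their locations -/

theorem mem_locsOf {T : Ty B} {l : B.full.Loc} : l ∈ locsOf T ↔ ∀ g ∈ T, l ∈ g.locs := by
  simp [locsOf]

theorem locsOf_anti {T T' : Ty B} (h : T' ⊆ T) : locsOf T ⊆ locsOf T' :=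
  fun _ hl => mem_locsOf.2 fun g hg => mem_locsOf.1 hl g (h hg)

@[simp] theorem locsOf_empty : locsOf (∅ : Ty B) = Set.univ := by
  simp [locsOf]

@[simp] theorem not_isValid_empty : ¬ isValid (∅ : Ty B) := by
  simp [isValid]

theorem isValid.mono {T T' : Ty B} (h : T ⊆ T') (hT : isValid T) : isValid T' :=
  Set.Nonempty.mono (Set.inter_subset_inter_left _ h) hT

theorem isValid_union {T T' : Ty B} : isValid (T ∪ T') ↔ isValid T ∨ isValid T' := by
  simp [isValid, Set.union_inter_distrib_right, Set.union_nonempty]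

theorem isValid_of_lcl {T : Ty B} (h : .lcl ∈ T) : isValid T := ⟨.lcl, h, by simp⟩

theorem isValid_of_actv {T : Ty B} (h : .actv ∈ T) : isValid T := ⟨.actv, h, by simp⟩

theorem CheckEps.refl (Γ : Env B V) : CheckEps Γ Γ := fun _ => ⟨le_rfl, id, le_rfl⟩

theorem CheckEps.trans {Γ₁ Γ₂ Γ₃ : Env B V} (h : CheckEps Γ₁ Γ₂) (h' : CheckEps Γ₂ Γ₃) :
    CheckEps Γ₁ Γ₃ := fun x =>
  ⟨(h x).1.trans (h' x).1, (h x).2.1 ∘ (h' x).2.1, (h' x).2.2.trans (h x).2.2⟩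

theorem Trans.mem {T T' : Ty B} {L : Set B.full.Loc} (h : Trans T L T') {g : Guar B}
    (hg : g = .lcl ∨ g = .actv) (hT : g ∈ T') : g ∈ T :=
  (h.2.2 ⟨hg, hT⟩).2

/-! ### Typed steps of statements -/

/-- Type rules for commands, including the delimiters of atomic blocks. -/
inductive TypeAct : Env B W.src → Com S W.src → Env B W.src → Prop
  | com (Γ Γ' : Env B W.src) (c : Com S W.src) : TypeCom Γ c Γ' → TypeAct Γ c Γ'
  | beginA (Γ : Env B W.src) : TypeAct Γ .beginAtomic Γ
  | endA (Γ : Env B W.src) : TypeAct Γ .endAtomic (rmTransient Γ)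

/-- The inference rule also applies to `skip`, so the two environments are related by subtyping and
need not be equal. -/
theorem TypeStmt.skip_inv {Γ Γ' : Env B W.src} {s : Stmt S W.src} (h : TypeStmt Γ s Γ')
    (hs : s = .skip) : CheckEps Γ Γ' := by
  induction h with
  | skip Γ => exact .refl Γ
  | infer Γ₁ Γ₂ Γ₃ Γ₄ s h₁ _ h₃ ih => exact (h₁.trans (ih hs)).trans h₃
  | _ => cases hs

theorem Stmt.map_eq_skip {V' : Vars.{u}} {f : VMap V V'} {s : Stmt S V} :
    s.map f = .skip ↔ s = .skip := by
  cases s <;> simp [Stmt.map]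

/-- The action of a step of a typed statement is typed, and so is the remaining statement. -/
theorem TypeStmt.step {Γ Γ' : Env B W.src} {s : Stmt S W.src} (h : TypeStmt Γ s Γ')
    {t : S.Thread} {o : List (Act S (W.rt S))} {r : Stmt S (W.rt S)}
    (hs : SStep t (s.map (W.index t)) o r) :
    ∃ (s' : Stmt S W.src) (Γ₁ Γ₂ : Env B W.src), r = s'.map (W.index t) ∧ CheckEps Γ Γ₁ ∧
      TypeStmt Γ₂ s' Γ' ∧ ((o = [] ∧ Γ₂ = Γ₁) ∨
        ∃ c up, o = [.exec t (c.map (W.index t)) up] ∧ TypeAct Γ₁ c Γ₂) := by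
  induction h generalizing o r with
  | com Γ Γ' c hc =>
    simp only [Stmt.map] at hs
    cases hs with
    | com c up =>
      exact ⟨.skip, Γ, Γ', rfl, .refl _, .skip _, Or.inr ⟨_, up, rfl, .com _ _ _ hc⟩⟩
  | beginA Γ =>
    simp only [Stmt.map] at hs
    cases hs with
    | com c up =>
      exact ⟨.skip, Γ, Γ, rfl, .refl _, .skip _, Or.inr ⟨_, up, rfl, .beginA _⟩⟩
  | endA Γ =>
    simp only [Stmt.map] at hs
    cases hs with
    | com c up =>
      exact ⟨.skip, Γ, _, rfl, .refl _, .skip _, Or.inr ⟨_, up, rfl, .endA _⟩⟩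
  | skip Γ =>
    simp only [Stmt.map] at hs
    cases hs
  | infer Γ₁ Γ₂ Γ₃ Γ₄ s h₁ _ h₃ ih =>
    obtain ⟨s', Γ, Γ', hr, he, ht, ho⟩ := ih hs
    -- The weakening before the statement joins the silent change in front of the action; the one
    -- after it is kept in the typing of the remaining statement.
    exact ⟨s', Γ, Γ', hr, h₁.trans he, .infer _ _ _ _ _ (.refl _) ht h₃, ho⟩
  | choice Γ Γ' s₁ s₂ h₁ h₂ =>
    simp only [Stmt.map] at hs
    cases hs with
    | left => exact ⟨s₁, Γ, Γ, rfl, .refl _, h₁, Or.inl ⟨rfl, rfl⟩⟩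
    | right => exact ⟨s₂, Γ, Γ, rfl, .refl _, h₂, Or.inl ⟨rfl, rfl⟩⟩
  | loop Γ s h₁ =>
    simp only [Stmt.map] at hs
    cases hs with
    | loopStop => exact ⟨.skip, Γ, Γ, rfl, .refl _, .skip _, Or.inl ⟨rfl, rfl⟩⟩
    | loopLast => exact ⟨s, Γ, Γ, rfl, .refl _, h₁, Or.inl ⟨rfl, rfl⟩⟩
    | loopMore =>
      exact ⟨.seq s (.loop s), Γ, Γ, rfl, .refl _, .seq _ _ _ _ _ h₁ (.loop _ _ h₁),
        Or.inl ⟨rfl, rfl⟩⟩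
  | seq Γ Γ' Γ'' s₁ s₂ h₁ h₂ ih₁ =>
    simp only [Stmt.map] at hs
    generalize hr₁ : s₁.map (W.index t) = r₁ at hs ih₁
    cases hs with
    | skip =>
      exact ⟨s₂, Γ', Γ', rfl, h₁.skip_inv (Stmt.map_eq_skip.1 hr₁), h₂, Or.inl ⟨rfl, rfl⟩⟩
    | seq _ r₁' _ _ _ hs =>
      obtain ⟨s', Γ₁, Γ₂, rfl, he, ht, ho⟩ := ih₁ hs
      exact ⟨.seq s' s₂, Γ₁, Γ₂, rfl, he, .seq _ _ _ _ _ ht h₂, ho⟩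

/-! ### Soundness of type environments -/

/-- The address `a` meets the type `T` from the perspective of thread `t`. -/
structure AdrOK (t : S.Thread) (τ : Comp S V) (a : S.Adr) (T : Ty B) : Prop where
  live : isValid T → a ∉ freed τ
  locs : a ∉ freed τ → ∀ (φ : Valu S X Y) l, φ.thr .zt = t → φ.adr .za = a →
    B.full.Run φ B.full.init (history (elide τ)) l → l ∈ locsOf T

theorem AdrOK.mono {t : S.Thread} {τ : Comp S V} {a : S.Adr} {T T' : Ty B} (h : AdrOK t τ a T)
    (hv : isValid T' → isValid T) (hl : locsOf T ⊆ locsOf T') : AdrOK t τ a T' :=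
  ⟨fun hT => h.live (hv hT), fun ha φ l ht hz hr => hl (h.locs ha φ l ht hz hr)⟩

theorem AdrOK.subset {t : S.Thread} {τ : Comp S V} {a : S.Adr} {T T' : Ty B}
    (h : AdrOK t τ a T) (hT : T' ⊆ T) : AdrOK t τ a T' :=
  h.mono (isValid.mono hT) (locsOf_anti hT)

theorem AdrOK.empty (t : S.Thread) (τ : Comp S V) (a : S.Adr) : AdrOK t τ a (∅ : Ty B) :=
  ⟨fun h => (not_isValid_empty h).elim, fun _ _ _ _ _ _ => by simp⟩

theorem AdrOK.union {t : S.Thread} {τ : Comp S V} {a : S.Adr} {T T' : Ty B}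
    (h : AdrOK t τ a T) (h' : AdrOK t τ a T') : AdrOK t τ a (T ∪ T') := by
  refine ⟨fun hv => (isValid_union.1 hv).elim h.live h'.live, fun ha φ l ht hz hr => ?_⟩
  refine mem_locsOf.2 fun g hg => hg.elim ?_ ?_
  · exact mem_locsOf.1 (h.locs ha φ l ht hz hr) g
  · exact mem_locsOf.1 (h'.locs ha φ l ht hz hr) g

/-- An address that is neither freed nor retired meets the guarantees `𝕃` and `𝔸`. -/
theorem AdrOK.of_not_retired {t : S.Thread} {τ : Comp S V} {a : S.Adr} {g : Guar B}
    (hg : g = .lcl ∨ g = .actv) (hf : a ∉ freed τ) (hr : a ∉ retired (elide τ)) :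
    AdrOK t τ a ({g} : Ty B) := by
  refine ⟨fun _ => hf, fun _ φ l _ hz hrun => mem_locsOf.2 ?_⟩
  subst hz
  rintro _ rfl
  have := run_elide_init hrun hr
  rcases hg with rfl | rfl <;> exact this

theorem AdrOK.silent {t t' : S.Thread} {c : Com S V} {up : List (Upd S V)} {τ : Comp S V}
    {a : S.Adr} {T : Ty B} (hτ : EnabledAll τ) (he : Enabled Set.univ ∅ τ (.exec t' c up))
    (hc : c.event? (heap τ) t' = none) (h : AdrOK t τ a T) :
    AdrOK t (.exec t' c up :: τ) a T := by
  have hh : history (elide (.exec t' c up :: τ)) = history (elide τ) := by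
    simp [history_exec, hc]
  constructor
  · rw [freed_exec hτ he]; exact h.live
  · rw [freed_exec hτ he, hh]; exact h.locs

/-- The addresses that a pointer or angel of thread `t` stands for. -/
def vals (m : Mem S (W.rt S)) (ρ : (W.rt S).AV → Set S.Adr) (t : S.Thread) :
    W.src.PV ⊕ W.src.AV → Set S.Adr
  | .inl p => {a | m.pvar ((W.index t).p p) = some a}
  | .inr r => ρ ((W.index t).a r)

/-- The type environment `Γ` of thread `t` is sound after `τ`, where `ρ` interprets the angels. -/
structure Sound (t : S.Thread) (τ : Comp S (W.rt S)) (ρ : (W.rt S).AV → Set S.Adr)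
    (Γ : Env B W.src) : Prop where
  adr : ∀ x, ∀ a ∈ vals (heap τ) ρ t x, AdrOK t τ a (Γ x)
  lcl : ∀ p, .lcl ∈ Γ (.inl p) → ∀ a, (heap τ).pvar ((W.index t).p p) = some a →
    Sole (heap τ) ((W.index t).p p) a
  angel : ∀ r, .lcl ∉ Γ (.inr r)

/-- The type environment relies on nothing that may change outside atomic blocks. -/
structure Stable (Γ : Env B W.src) : Prop where
  not_valid : ∀ p, ¬ isValid (Γ (.inl (.inl p)))
  locs : ∀ p, locsOf (Γ (.inl (.inl p))) = Set.univ
  actv : ∀ x, .actv ∉ Γ x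

theorem Sound.eps {t : S.Thread} {τ : Comp S (W.rt S)} {ρ : (W.rt S).AV → Set S.Adr}
    {Γ Γ' : Env B W.src} (h : Sound t τ ρ Γ) (he : CheckEps Γ Γ') : Sound t τ ρ Γ' where
  adr x a ha := (h.adr x a ha).mono (he x).2.1 (he x).1
  lcl p hp := h.lcl p ((he _).mem (Or.inl rfl) hp)
  angel r hr := h.angel r ((he _).mem (Or.inl rfl) hr)

/-- Subtyping may give a shared pointer a nonempty type, for instance a custom guarantee for the set
of all locations. For this reason `Stable` asks for an invalid type with all locations instead of
the empty type. -/
theorem Stable.eps {Γ Γ' : Env B W.src} (h : Stable Γ) (he : CheckEps Γ Γ') : Stable Γ' where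
  not_valid p hp := h.not_valid p ((he _).2.1 hp)
  locs p := Set.univ_subset_iff.1 ((h.locs p) ▸ (he _).1)
  actv x hx := h.actv x ((he _).mem (Or.inr rfl) hx)

theorem Stable.empty : Stable (fun _ => ∅ : Env B W.src) where
  not_valid _ := not_isValid_empty
  locs _ := locsOf_empty
  actv _ := Set.notMem_empty _

theorem Stable.rmTransient (Γ : Env B W.src) : Stable (rmTransient Γ) where
  not_valid _ := not_isValid_empty
  locs _ := locsOf_empty
  actv x := by rcases x with (p | p) | r <;> simp [SMR.rmTransient]

theorem Sound.nil (t : S.Thread) (ρ : (W.rt S).AV → Set S.Adr) :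
    Sound t [] ρ (fun _ => ∅ : Env B W.src) where
  adr _ _ _ := .empty _ _ _
  lcl _ h := (Set.notMem_empty _ h).elim
  angel _ := Set.notMem_empty _

/-- This is the bridge from types to pointer races: a valid type means an unfreed value, and an
unfreed value means a valid expression. -/
theorem Sound.mem_valid {t : S.Thread} {τ : Comp S (W.rt S)} {ρ : (W.rt S).AV → Set S.Adr}
    {Γ : Env B W.src} (h : Sound t τ ρ Γ) (hv : ValidInv τ) {p : W.src.PV}
    (hp : isValid (Γ (.inl p))) : .var ((W.index t).p p) ∈ valid τ :=
  (hv.var _).2 fun a ha => (h.adr (.inl p) a ha).live hp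

/-! ### Interference -/

theorem Com.map_tgt {V' : Vars.{u}} (f : VMap V V') (c : Com S V) :
    (c.map f).tgt ⊆ Set.range f.p := by
  cases c <;> simp [Com.map, Com.tgt]

theorem Com.map_src {V' : Vars.{u}} (f : VMap V V') (c : Com S V) :
    (c.map f).src ⊆ Set.range f.p := by
  cases c <;> simp [Com.map, Com.src]

theorem local_notMem_range {t t' : S.Thread} (h : t' ≠ t) (p : W.LV) :
    (W.index t').p (.inr p) ∉ Set.range (W.index t).p := by
  rintro ⟨q | q, hq⟩
  · simp [PVars.index] at hq
  · simp only [PVars.index, Sum.map_inr, Sum.inr.injEq, Prod.mk.injEq] at hq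
    exact h hq.1.symm

theorem event?_cases {m : Mem S V} {t : S.Thread} {c : Com S V} {e : Event S}
    (h : c.event? m t = some e) :
    (∃ f ps us as ds, c = .enter f ps us ∧ e = .enter f t as ds ∧
      ∀ i, m.pvar (ps i) = some (as i)) ∨ ∃ f, e = .exit f t := by
  cases c <;> simp only [Com.event?, reduceCtorEq, Option.some.injEq] at h
  · rename_i f ps us
    split_ifs at h with hs
    cases h
    exact Or.inl ⟨f, ps, us, _, _, rfl, rfl, fun i => by simp⟩
  · exact Or.inr ⟨_, h.symm⟩

theorem Aut.Closed.step {A : Aut S X Y} {L : Set A.Loc} (hL : A.Closed L) {φ : Valu S X Y}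
    {l l' : A.Loc} {m : Mem S V} {t : S.Thread} {c : Com S V} {e : Event S}
    (hc : c.event? m t = some e) (ht : φ.thr .zt ≠ t) (hs : A.Step φ l e l') (hl : l ∈ L) :
    l' ∈ L := by
  by_contra hl'
  obtain ⟨g, hg, hv⟩ := hs
  rcases event?_cases hc with ⟨f, -, -, as, ds, -, rfl, -⟩ | ⟨f, rfl⟩
  · exact ht (hL.1 f l g l' hg hl hl' φ t as ds hv).symm
  · exact ht (hL.2 f l g l' hg hl hl' φ t hv).symm

/-- Types of unlocked threads are not affected by actions of other threads. -/
theorem Sound.interfere {t t' : S.Thread} (htt : t' ≠ t) {c : Com S W.src}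
    {up : List (Upd S (W.rt S))} {τ : Comp S (W.rt S)} {ρ ρ' : (W.rt S).AV → Set S.Adr}
    {Γ : Env B W.src} (hτ : EnabledAll τ)
    (he : Enabled Set.univ ∅ τ (.exec t (c.map (W.index t)) up))
    (hρ : ∀ r, ρ' (t', r) = ρ (t', r)) (h : Sound t' τ ρ Γ) (hst : Stable Γ) :
    Sound t' (.exec t (c.map (W.index t)) up :: τ) ρ' Γ := by
  have hval : ∀ p, (heap (.exec t (c.map (W.index t)) up :: τ)).pvar ((W.index t').p (.inr p))
      = (heap τ).pvar ((W.index t').p (.inr p)) := fun p =>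
    pvar_exec he fun hp => local_notMem_range htt p (Com.map_tgt _ _ hp)
  have key : ∀ x a, (∀ p, x ≠ .inl (.inl p)) → a ∈ vals (heap τ) ρ t' x →
      AdrOK t' (.exec t (c.map (W.index t)) up :: τ) a (Γ x) := by
    intro x a hx ha
    have hok := h.adr x a ha
    cases hc : (c.map (W.index t)).event? (heap τ) t with
    | none => exact hok.silent hτ he hc
    | some e =>
      constructor
      · rw [freed_exec hτ he]; exact hok.live
      · rw [freed_exec hτ he]
        intro hfr φ l hz hza hrun
        rw [elide_exec, history_exec, heap_elide, hc, Option.toList_some, Aut.run_append] at hrun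
        obtain ⟨l₁, h₁, h₂⟩ := hrun
        rw [Aut.run_singleton] at h₂
        have hl₁ := mem_locsOf.1 (hok.locs hfr φ l₁ hz hza h₁)
        have ht : φ.thr .zt ≠ t := hz ▸ htt
        refine mem_locsOf.2 fun g hg => ?_
        have hgl := hl₁ g hg
        -- The guarantee `actv` is absent from stable environments, and the locations of `safe` and
        -- `custom` are closed under steps of threads other than `z_t`. Only `lcl` needs an argument
        -- about aliasing.
        cases g with
        | actv => exact absurd hg (hst.actv x)
        | safe => exact (Aut.safeLoc_isGreatest _).1.1.step hc ht h₂ hgl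
        | custom L hL => exact hL.step hc ht h₂ hgl
        | lcl =>
          rcases x with (p | p) | r
          · exact absurd rfl (hx p)
          · have hb := Aut.step_base h₂
            have hgl' : l₁.1 = .init := hgl
            rw [hgl'] at hb
            rcases event?_cases hc with ⟨f, ps, us, as, ds, hce, rfl, hps⟩ | ⟨f, rfl⟩
            · refine base_step_init hb (by simp) fun t₁ as' ds' heq hza' => ?_
              cases heq
              -- A `retire` of `a` by `t` has an argument variable of `t` with value `a`; uniqueness
              -- would make it a local variable of `t'`.
              have hsole := (h.lcl _ hg a ha).1 _ (by rw [hps, hza', hza])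
              cases c <;> simp only [Com.map, reduceCtorEq, Com.enter.injEq] at hce
              rename_i f ps' us'
              obtain ⟨rfl, hce, -⟩ := hce
              cases hce
              exact local_notMem_range htt p ⟨_, hsole⟩
            · exact base_step_init hb (by simp) (by simp)
          · exact absurd hg (h.angel r)
  constructor
  · rintro ((p | p) | r) a ha
    -- The other thread may have overwritten this shared pointer, but stability makes its type claim
    -- nothing.
    · refine ⟨fun hv => (hst.not_valid p hv).elim, fun _ φ l _ _ _ => ?_⟩
      rw [hst.locs p]; trivial
    · refine key _ a (by simp) ?_
      simpa only [vals, Set.mem_ofPred_eq, hval] using ha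
    · refine key _ a (by simp) ?_
      have : a ∈ ρ' (t', r) := ha
      rwa [hρ] at this
  · rintro (p | p) hp a ha
    · exact absurd (isValid_of_lcl hp) (hst.not_valid p)
    · rw [hval] at ha
      exact (h.lcl _ hp a ha).exec hτ he
        (fun hp => local_notMem_range htt p (Com.map_src _ _ hp)) ha
  · exact h.angel

/-- Soundness is not affected by frees. -/
theorem Sound.free (hB : B.full.Admissible) {t : S.Thread} {τ : Comp S (W.rt S)}
    {ρ : (W.rt S).AV → Set S.Adr} {Γ : Env B W.src} (hτ : EnabledAll τ) {b : S.Adr}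
    (hs : history (.free b :: τ) ∈ B.full.Spec) (h : Sound t τ ρ Γ) :
    Sound t (.free b :: τ) ρ Γ where
  adr x a ha := by
    have hok := h.adr x a ha
    constructor
    · rintro hv (hf | rfl)
      · exact hok.live hv hf
      -- The types constrain runs with `z_t = t` and `z_a = a`; the values of the further variables
      -- are arbitrary. Each guarantee that makes a type valid confines such a run to `init` or to
      -- safe locations.
      · let φ : Valu S X Y := ⟨fun _ => t, fun _ => a⟩
        obtain ⟨l, hl⟩ := hB.exists_run φ B.full.init (history (elide τ))
        have hloc := mem_locsOf.1 (hok.locs (hok.live hv) φ l rfl rfl hl)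
        refine not_free_of_safe hB hτ hs (hok.live hv) (φ := φ) rfl hl ?_
        obtain ⟨g, hg, rfl | rfl | rfl⟩ := hv
        · exact Or.inr (hloc _ hg)
        · exact Or.inl (hloc _ hg)
        · exact Or.inl (hloc _ hg)
    -- The elided history is the same before and after the `free`.
    · exact fun hf => hok.locs fun hf' => hf (Or.inl hf')
  lcl := h.lcl
  angel := h.angel

/-! ### Actions of a thread under its own type environment -/

theorem index_injective (t : S.Thread) : Function.Injective (W.index t).p := by
  rintro (p | p) (q | q) h <;> simp_all [PVars.index]

theorem index_angel_injective (t : S.Thread) : Function.Injective (W.index t).a := by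
  intro p q h
  simp_all [PVars.index]

/-- The memory as seen by a thread. -/
def Mem.view (m : Mem S (W.rt S)) (t : S.Thread) : Mem S W.src where
  pvar p := m.pvar ((W.index t).p p)
  psel := m.psel
  dvar d := m.dvar ((W.index t).d d)
  dsel := m.dsel

/-- The set `post` in the typing rules ranges over memories for the variables of the program text,
so an event of the indexed command must be reproduced in such a memory. -/
theorem event?_view (m : Mem S (W.rt S)) (t : S.Thread) (c : Com S W.src) :
    (c.map (W.index t)).event? m t = c.event? (m.view t) t := by
  cases c <;> rfl

theorem Env.set_apply (Γ : Env B V) (x y : V.PV ⊕ V.AV) (T : Ty B) [Decidable (y = x)] :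
    Γ.set x T y = if y = x then T else Γ y := by
  classical
  simp only [Env.set, Function.update_apply]
  congr

theorem vals_exec {t : S.Thread} {c : Com S W.src} {up : List (Upd S (W.rt S))}
    {τ : Comp S (W.rt S)} {ρ : (W.rt S).AV → Set S.Adr}
    (he : Enabled Set.univ ∅ τ (.exec t (c.map (W.index t)) up)) {x : W.src.PV ⊕ W.src.AV}
    (hx : ∀ p, x = .inl p → (W.index t).p p ∉ (c.map (W.index t)).tgt) :
    vals (heap (.exec t (c.map (W.index t)) up :: τ)) ρ t x = vals (heap τ) ρ t x := by
  rcases x with p | r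
  · simp only [vals, pvar_exec he (hx p rfl)]
  · rfl

/-- Soundness is preserved by commands without event, if the new types are met before the
command. -/
theorem Sound.silent {t : S.Thread} {c : Com S W.src} {up : List (Upd S (W.rt S))}
    {τ : Comp S (W.rt S)} {ρ ρ' : (W.rt S).AV → Set S.Adr} {Γ Γ' : Env B W.src}
    (hτ : EnabledAll τ) (he : Enabled Set.univ ∅ τ (.exec t (c.map (W.index t)) up))
    (hc : (c.map (W.index t)).event? (heap τ) t = none) (h : Sound t τ ρ Γ)
    (hadr : ∀ x, ∀ a ∈ vals (heap (.exec t (c.map (W.index t)) up :: τ)) ρ' t x,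
      AdrOK t τ a (Γ' x))
    (hlcl : ∀ p, .lcl ∈ Γ' (.inl p) → .lcl ∈ Γ (.inl p) ∧
      (W.index t).p p ∉ (c.map (W.index t)).tgt ∧ (W.index t).p p ∉ (c.map (W.index t)).src)
    (hang : ∀ r, .lcl ∈ Γ' (.inr r) → .lcl ∈ Γ (.inr r)) :
    Sound t (.exec t (c.map (W.index t)) up :: τ) ρ' Γ' where
  adr x a ha := (hadr x a ha).silent hτ he hc
  lcl p hp a ha := by
    obtain ⟨h₁, h₂, h₃⟩ := hlcl p hp
    rw [pvar_exec he h₂] at ha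
    exact (h.lcl p h₁ a ha).exec hτ he h₃ ha
  angel r hr := h.angel r (hang r hr)

/-- Soundness is preserved by calls and returns of SMR functions. -/
theorem Sound.event {t : S.Thread} {c : Com S W.src} {up : List (Upd S (W.rt S))}
    {τ : Comp S (W.rt S)} {ρ : (W.rt S).AV → Set S.Adr} {Γ Γ' : Env B W.src}
    (hτ : EnabledAll τ) (he : Enabled Set.univ ∅ τ (.exec t (c.map (W.index t)) up))
    {e : Event S} (hc : (c.map (W.index t)).event? (heap τ) t = some e) (h : Sound t τ ρ Γ)
    (hup : up = []) (hΓ : CheckCom Γ c Γ') :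
    Sound t (.exec t (c.map (W.index t)) up :: τ) ρ Γ' := by
  subst hup
  constructor
  · intro x a ha
    have ha' : a ∈ vals (heap τ) ρ t x := ha
    have hok := h.adr x a ha'
    constructor
    · rw [freed_exec hτ he]
      exact fun hv => hok.live ((hΓ x).2.1 hv)
    · rw [freed_exec hτ he]
      intro hf φ l hz hza hrun
      rw [elide_exec, history_exec, heap_elide, hc, Option.toList_some, Aut.run_append] at hrun
      obtain ⟨l₁, h₁, h₂⟩ := hrun
      rw [Aut.run_singleton] at h₂
      rw [event?_view] at hc
      refine (hΓ x).1 ⟨l₁, φ, (heap τ).view t, t, e, hc, h₂, hok.locs hf φ l₁ hz hza h₁, hz, ?_⟩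
      rintro p rfl
      rw [hza]
      exact ha'
  · exact fun p hp => h.lcl p ((hΓ _).mem (Or.inl rfl) hp)
  · exact fun r hr => h.angel r ((hΓ _).mem (Or.inl rfl) hr)

/-- The annotation formula is consumed together with the action: an annotation yields a fact about
the elided computation, whose memory is that of `τ`, and the quantifier of an angel yields a new
interpretation `ρ'`. Only angels of the acting thread change, so the other threads are not
disturbed. -/
theorem Sound.own (hB : B.full.Admissible) {t : S.Thread} {c : Com S W.src}
    {up : List (Upd S (W.rt S))} {τ : Comp S (W.rt S)} {ρ : (W.rt S).AV → Set S.Adr}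
    {Γ Γ' : Env B W.src} {w : List (Act S (W.rt S))}
    (hτ : EnabledAll τ) (he : Enabled Set.univ ∅ τ (.exec t (c.map (W.index t)) up))
    (hs : history τ ∈ B.full.Spec) (h : Sound t τ ρ Γ) (hc : TypeAct Γ c Γ')
    (hinv : InvFrom (elide τ) ρ (.exec t (c.map (W.index t)) up :: w)) :
    ∃ ρ' : (W.rt S).AV → Set S.Adr, (∀ t' r, t' ≠ t → ρ' (t', r) = ρ (t', r)) ∧
      InvFrom (elide (.exec t (c.map (W.index t)) up :: τ)) ρ' w ∧
      Sound t (.exec t (c.map (W.index t)) up :: τ) ρ' Γ' := by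
  classical
  have : Nonempty S.Thread := ⟨t⟩
  have hinj := index_injective (W := W) t
  have hal := hτ.allocInv
  have hsame : ∀ x, (∀ p, x = .inl p → (W.index t).p p ∉ (c.map (W.index t)).tgt) →
      ∀ a ∈ vals (heap (.exec t (c.map (W.index t)) up :: τ)) ρ t x, AdrOK t τ a (Γ x) := by
    intro x hx a ha
    rw [vals_exec he hx] at ha
    exact h.adr x a ha
  cases hc with
  | beginA =>
    refine ⟨ρ, fun _ _ _ => rfl, hinv, h.silent hτ he rfl ?_ ?_ ?_⟩
    · exact fun x => hsame x fun _ _ => Set.notMem_empty _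
    · exact fun p hp => ⟨hp, Set.notMem_empty _, Set.notMem_empty _⟩
    · exact fun r hr => hr
  | endA =>
    refine ⟨ρ, fun _ _ _ => rfl, hinv, h.silent hτ he rfl ?_ ?_ ?_⟩
    · intro x a ha
      have := hsame x (fun _ _ => Set.notMem_empty _) a ha
      rcases x with (p | p) | r
      exacts [.empty _ _ _, this.subset Set.sdiff_subset, this.subset Set.sdiff_subset]
    · rintro (p | p) hp
      · exact (Set.notMem_empty _ hp).elim
      · exact ⟨hp.1, Set.notMem_empty _, Set.notMem_empty _⟩
    · exact fun r hr => hr.1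
  | com _ _ hc =>
    cases hc with
    | assign1 p q =>
      have hup : up = [.pvar ((W.index t).p p) ((heap τ).pvar ((W.index t).p q))] := he
      refine ⟨ρ, fun _ _ _ => rfl, hinv, h.silent hτ he rfl ?_ ?_ ?_⟩
      · intro x a ha
        by_cases hxp : x = .inl p
        · subst hxp hup
          simp only [Env.set_apply, if_true]
          refine (h.adr (.inl q) a ?_).subset Set.sdiff_subset
          simpa [vals, heap, Mem.upd] using ha
        · have := hsame x (by rintro p' rfl h'; exact hxp (by rw [hinj h'])) a ha
          simp only [Env.set_apply, if_neg hxp]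
          split_ifs with hxq
          · subst hxq
            exact this.subset Set.sdiff_subset
          · exact this
      · intro x hx
        by_cases hxp : x = p
        · simp [Env.set_apply, hxp] at hx
        · by_cases hxq : x = q
          · simp [Env.set_apply, hxq] at hx
          · simp only [Env.set_apply, Sum.inl.injEq, hxp, hxq, if_false] at hx
            exact ⟨hx, fun h' => hxp (hinj h'), fun h' => hxq (hinj h')⟩
      · exact fun r hr => by simpa [Env.set_apply] using hr
    | assign2 p q hq =>
      refine ⟨ρ, fun _ _ _ => rfl, hinv, h.silent hτ he rfl ?_ ?_ ?_⟩
      · intro x a ha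
        by_cases hxp : x = .inl p
        · simp only [Env.set_apply, hxp, if_true]
          exact .empty _ _ _
        · simp only [Env.set_apply, if_neg hxp]
          exact hsame x (by rintro p' rfl h'; exact hxp (by rw [hinj h'])) a ha
      · intro x hx
        by_cases hxp : x = p
        · simp [Env.set_apply, hxp] at hx
        · simp only [Env.set_apply, Sum.inl.injEq, hxp, if_false] at hx
          exact ⟨hx, fun h' => hxp (hinj h'), Set.notMem_empty _⟩
      · exact fun r hr => by simpa [Env.set_apply] using hr
    | assign3 p q hp =>
      refine ⟨ρ, fun _ _ _ => rfl, hinv, h.silent hτ he rfl ?_ ?_ ?_⟩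
      · intro x a ha
        have := hsame x (fun _ _ => Set.notMem_empty _) a ha
        simp only [Env.set_apply]
        split_ifs with hxq
        · subst hxq
          exact this.subset Set.sdiff_subset
        · exact this
      · intro x hx
        by_cases hxq : x = q
        · simp [Env.set_apply, hxq] at hx
        · simp only [Env.set_apply, Sum.inl.injEq, hxq, if_false] at hx
          exact ⟨hx, Set.notMem_empty _, fun h' => hxq (hinj h')⟩
      · exact fun r hr => by simpa [Env.set_apply] using hr
    | assign4 | assign5 | assign6 | assume2 =>
      refine ⟨ρ, fun _ _ _ => rfl, hinv, h.silent hτ he rfl ?_ ?_ ?_⟩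
      · exact fun x => hsame x fun _ _ => Set.notMem_empty _
      · exact fun p hp => ⟨hp, Set.notMem_empty _, Set.notMem_empty _⟩
      · exact fun r hr => hr
    | malloc p =>
      -- `Sound.silent` does not apply to this command, since the guarantee `lcl` is newly acquired
      -- and comes from the freshness of the returned address.
      have hm := fun a => sole_malloc (a := a) hτ he
      refine ⟨ρ, fun _ _ _ => rfl, hinv, ⟨?_, ?_, ?_⟩⟩
      · intro x a ha
        refine AdrOK.silent hτ he rfl ?_
        by_cases hxp : x = .inl (.inr p)
        · subst hxp
          simp only [Env.set_apply, if_true]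
          have hf := (hm a ha).1
          exact .of_not_retired (Or.inl rfl) (fun h' => hal.freed a h' hf)
            fun h' => hal.retired a h' hf
        · simp only [Env.set_apply, if_neg hxp]
          exact hsame x (by rintro p' rfl h'; exact hxp (by rw [hinj h'])) a ha
      · intro x hx a ha
        by_cases hxp : x = .inr p
        · subst hxp
          exact (hm a ha).2
        · simp only [Env.set_apply, Sum.inl.injEq, hxp, if_false] at hx
          rw [pvar_exec he fun h' => hxp (hinj h')] at ha
          exact (h.lcl x hx a ha).exec hτ he (Set.notMem_empty _) ha
      · intro r hr
        exact h.angel r (by simpa [Env.set_apply] using hr)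
    | assume1 p q T hp hq hT =>
      have hpq : (heap τ).pvar ((W.index t).p p) = (heap τ).pvar ((W.index t).p q) := he.1
      refine ⟨ρ, fun _ _ _ => rfl, hinv, h.silent hτ he rfl ?_ ?_ ?_⟩
      · intro x a ha
        have hx := hsame x (fun _ _ => Set.notMem_empty _) a ha
        rw [vals_exec he fun _ _ => Set.notMem_empty _] at ha
        simp only [Env.set_apply, hT]
        split_ifs with hxq hxp
        · subst hxq
          exact ((h.adr (.inl p) a (hpq.trans ha)).union hx).subset Set.sdiff_subset
        · subst hxp
          exact (hx.union (h.adr (.inl q) a (hpq.symm.trans ha))).subset Set.sdiff_subset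
        · exact hx
      · intro x hx
        simp only [Env.set_apply, hT] at hx
        split_ifs at hx with hxq hxp
        · exact absurd rfl hx.2
        · exact absurd rfl hx.2
        · exact ⟨hx, Set.notMem_empty _, Set.notMem_empty _⟩
      · exact fun r hr => by simpa [Env.set_apply] using hr
    | equal p q T hT =>
      obtain ⟨hpq, hinv⟩ := hinv
      rw [heap_elide] at hpq
      have hup : up = [] := he
      subst hup
      refine ⟨ρ, fun _ _ _ => rfl, hinv, ⟨?_, ?_, ?_⟩⟩
      · intro x a ha
        refine AdrOK.silent hτ he rfl ?_
        have hx := hsame x (fun _ _ => Set.notMem_empty _) a ha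
        rw [vals_exec he fun _ _ => Set.notMem_empty _] at ha
        simp only [Env.set_apply, hT]
        split_ifs with hxq hxp
        · subst hxq
          exact (h.adr (.inl p) a (hpq.trans ha)).union hx
        · subst hxp
          exact hx.union (h.adr (.inl q) a (hpq.symm.trans ha))
        · exact hx
      · intro x hx a ha
        change Sole (heap τ) _ a
        have ha' : (heap τ).pvar ((W.index t).p x) = some a := ha
        -- The union of types may pass `lcl` from one variable to the other. If both hold the
        -- address `a`, uniqueness forces them to be the same variable, so nothing is lost.
        have key : ∀ y z, (heap τ).pvar ((W.index t).p y) = some a →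
            (heap τ).pvar ((W.index t).p z) = some a → .lcl ∈ Γ (.inl y) →
            Sole (heap τ) ((W.index t).p z) a := by
          intro y z hy hz hl
          have := h.lcl y hl a hy
          rwa [this.1 _ hz]
        simp only [Env.set_apply, hT, Sum.inl.injEq] at hx
        split_ifs at hx with hxq hxp
        · subst hxq
          exact hx.elim (key _ _ (hpq.trans ha') ha') (key _ _ ha' ha')
        · subst hxp
          exact hx.elim (key _ _ ha' ha') (key _ _ (hpq.symm.trans ha') ha')
        · exact key _ _ ha' ha' hx
      · intro r hr
        exact h.angel r (by simpa [Env.set_apply] using hr)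
    | activeP p =>
      obtain ⟨⟨b, hb, hpb⟩, hinv⟩ := hinv
      rw [heap_elide] at hpb
      -- The annotation speaks of the computation without frees, where activity only excludes
      -- retirement; that the address is unfreed in `τ` follows because freed addresses are retired
      -- there.
      obtain ⟨hb₁, hb₂⟩ := active_elide_not_freed hB hτ hs hb
      refine ⟨ρ, fun _ _ _ => rfl, hinv, h.silent hτ he rfl ?_ ?_ ?_⟩
      · intro x a ha
        have hx := hsame x (fun _ _ => Set.notMem_empty _) a ha
        rw [vals_exec he fun _ _ => Set.notMem_empty _] at ha
        simp only [Env.set_apply]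
        split_ifs with hxp
        · subst hxp
          obtain rfl : b = a := Option.some.inj (hpb.symm.trans ha)
          exact hx.union (.of_not_retired (Or.inr rfl) hb₁ hb₂)
        · exact hx
      · intro x hx
        refine ⟨?_, Set.notMem_empty _, Set.notMem_empty _⟩
        simp only [Env.set_apply] at hx
        split_ifs at hx with hxp
        · rw [hxp]; simpa using hx
        · exact hx
      · exact fun r hr => by simpa [Env.set_apply] using hr
    | activeR r =>
      obtain ⟨hact, hinv⟩ := hinv
      refine ⟨ρ, fun _ _ _ => rfl, hinv, h.silent hτ he rfl ?_ ?_ ?_⟩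
      · intro x a ha
        have hx := hsame x (fun _ _ => Set.notMem_empty _) a ha
        rw [vals_exec he fun _ _ => Set.notMem_empty _] at ha
        simp only [Env.set_apply]
        split_ifs with hxr
        · subst hxr
          obtain ⟨hb₁, hb₂⟩ := active_elide_not_freed hB hτ hs (hact ha)
          exact hx.union (.of_not_retired (Or.inr rfl) hb₁ hb₂)
        · exact hx
      · intro x hx
        refine ⟨?_, Set.notMem_empty _, Set.notMem_empty _⟩
        simpa [Env.set_apply] using hx
      · intro r' hr
        simp only [Env.set_apply] at hr
        split_ifs at hr with hrr
        · rw [hrr]; simpa using hr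
        · exact hr
    | angel r =>
      obtain ⟨R, hinv⟩ := hinv
      -- The new interpretation updates `ρ` at this angel by the witness `R`. Any `R` is sound, as
      -- the angel starts with the empty type.
      refine ⟨_, fun t' r' ht => ?_, hinv, h.silent hτ he rfl ?_ ?_ ?_⟩
      · exact dif_neg fun h' => ht (congrArg Prod.fst h')
      · intro x a ha
        by_cases hxr : x = .inr r
        · simp only [Env.set_apply, hxr, if_true]
          exact .empty _ _ _
        · simp only [Env.set_apply, if_neg hxr]
          refine hsame x (fun _ _ => Set.notMem_empty _) a ?_
          rcases x with p | r'
          · exact ha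
          · simp only [vals, Function.update] at ha ⊢
            rwa [dif_neg fun h' => hxr (by rw [index_angel_injective t h'])] at ha
      · intro x hx
        refine ⟨?_, Set.notMem_empty _, Set.notMem_empty _⟩
        simpa [Env.set_apply] using hx
      · intro r' hr
        simp only [Env.set_apply] at hr
        split_ifs at hr with hrr
        · exact (Set.notMem_empty _ hr).elim
        · exact hr
    | member p r =>
      obtain ⟨⟨b, hb, hpb⟩, hinv⟩ := hinv
      rw [heap_elide] at hpb
      refine ⟨ρ, fun _ _ _ => rfl, hinv, h.silent hτ he rfl ?_ ?_ ?_⟩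
      · intro x a ha
        have hx := hsame x (fun _ _ => Set.notMem_empty _) a ha
        rw [vals_exec he fun _ _ => Set.notMem_empty _] at ha
        simp only [Env.set_apply]
        split_ifs with hxp
        · subst hxp
          obtain rfl : b = a := Option.some.inj (hpb.symm.trans ha)
          exact hx.union (h.adr (.inr r) b hb)
        · exact hx
      · intro x hx
        refine ⟨?_, Set.notMem_empty _, Set.notMem_empty _⟩
        simp only [Env.set_apply] at hx
        split_ifs at hx with hxp
        -- Angels never carry `lcl`, so membership cannot introduce an unjustified claim of
        -- uniqueness.
        · rw [hxp]; exact hx.resolve_right (h.angel r)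
        · exact hx
      · exact fun r hr => by simpa [Env.set_apply] using hr
    | enter _ f ps us hsafe hchk hret =>
      have hdom : ∀ i, ((heap τ).pvar ((W.index t).p (ps i))).isSome := fun i =>
        Option.isSome_iff_ne_none.2 (he.1 i)
      exact ⟨ρ, fun _ _ _ => rfl, hinv, h.event hτ he (dif_pos hdom) he.2 hchk⟩
    | exit _ f hchk =>
      exact ⟨ρ, fun _ _ _ => rfl, hinv, h.event hτ he rfl he hchk⟩

/-! ### Absence of pointer races -/

/-- Each race involves an invalid pointer where the typing rule demands a valid type, or a call
whose safety the rule has established for all histories. For `retire` the required `actv` makes the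
type valid. -/
theorem Sound.not_race {t : S.Thread} {c : Com S W.src} {up : List (Upd S (W.rt S))}
    {τ : Comp S (W.rt S)} {ρ : (W.rt S).AV → Set S.Adr} {Γ Γ' : Env B W.src}
    (h : Sound t τ ρ Γ) (hc : TypeAct Γ c Γ') (hv : ValidInv τ) :
    ¬ RaisesRace B.full τ (.exec t (c.map (W.index t)) up) := by
  have hval : ∀ {p}, isValid (Γ (.inl p)) → .var ((W.index t).p p) ∈ valid τ := h.mem_valid hv
  rintro (⟨t', c', up', heq, p, hp, hpv⟩ | ⟨t', p, q, up', heq, hpq⟩ |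
    ⟨t', f, ps, us, up', heq, -, as, has, a, bs, hab, hsub⟩ | ⟨t', ps, us, up', heq, hps⟩)
  · obtain ⟨rfl, rfl, rfl⟩ := by simpa using heq
    cases hc with
    | beginA => exact hp
    | endA => exact hp
    | com _ _ hc =>
      cases hc with
      | assign2 _ _ hq | assign3 _ _ hq | assign5 _ _ hq | assign6 _ _ hq =>
        cases hp
        exact hpv (hval hq)
      | _ => exact hp
  · simp only [Act.exec.injEq] at heq
    obtain ⟨rfl, hce, rfl⟩ := heq
    cases hc with
    | beginA => cases hce
    | endA => cases hce
    | com _ _ hc =>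
      cases hc with
      | assume1 p q T hp hq =>
        cases hce
        exact hpq ⟨hval hp, hval hq⟩
      | assume2 c hne =>
        cases c with
        | eq p q => exact hne p q rfl
        | _ => cases hce
      | _ => cases hce
  · simp only [Act.exec.injEq] at heq
    obtain ⟨rfl, hce, rfl⟩ := heq
    cases hc with
    | beginA => cases hce
    | endA => cases hce
    | com _ _ hc =>
      cases hc with
      | enter _ f ps us hsafe =>
        cases hce
        -- Arguments of valid type are valid pointers, so argument lists that agree on the valid
        -- pointers agree wherever `SafeCall` asks for it.
        exact hsub (hsafe _ _ as bs a _ fun i hi => hab i (hi.imp_right fun h' => hval h'))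
      | _ => cases hce
  · simp only [Act.exec.injEq] at heq
    obtain ⟨rfl, hce, rfl⟩ := heq
    cases hc with
    | beginA => cases hce
    | endA => cases hce
    | com _ _ hc =>
      cases hc with
      | enter _ f ps us _ _ hret =>
        cases hce
        exact hps (hval (isValid_of_actv (hret rfl _)))
      | _ => cases hce

theorem not_race_free (A : Aut S X Y) (τ : Comp S V) (a : S.Adr) :
    ¬ RaisesRace A τ (.free a) := by
  simp [RaisesRace, UnsafeAccess, UnsafeAssumption, UnsafeCall, UnsafeRetire]

/-! ### Soundness of the type system -/

/-- The remaining program of thread `t` is typed by a sound environment, which is stable if the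
thread is not inside an atomic block. -/
def ThreadOK (B : Aut S X Y) (t : S.Thread) (τ : Comp S (W.rt S))
    (ρ : (W.rt S).AV → Set S.Adr) (r : Stmt S (W.rt S)) : Prop :=
  ∃ (s : Stmt S W.src) (Γ Γ' : Env B W.src), r = s.map (W.index t) ∧ TypeStmt Γ s Γ' ∧
    Sound t τ ρ Γ ∧ (t ∉ lockset τ → Stable Γ)

/-- A configuration with a race-free computation and typed threads, where `w` is the rest of the
computation (newest action first). -/
def ConfOK (B : Aut S X Y) (w τ : Comp S (W.rt S)) (pc : PC S (W.rt S)) : Prop :=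
  RaceFree B.full τ ∧ ∃ ρ, InvFrom (elide τ) ρ (elide w).reverse ∧
    ∀ t, ThreadOK B t τ ρ (pc t)

theorem ThreadOK.silent {t : S.Thread} {τ : Comp S (W.rt S)} {ρ : (W.rt S).AV → Set S.Adr}
    {r r' : Stmt S (W.rt S)} (h : ThreadOK B t τ ρ r) (hs : SStep t r [] r') :
    ThreadOK B t τ ρ r' := by
  obtain ⟨s, Γ, Γ', rfl, hty, hsd, hst⟩ := h
  obtain ⟨s', Γ₁, Γ₂, rfl, he, ht, ⟨-, rfl⟩ | ⟨c, up, ho, -⟩⟩ := hty.step hs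
  · exact ⟨s', Γ₂, Γ', rfl, ht, hsd.eps he, fun hl => (hst hl).eps he⟩
  · cases ho

theorem SStep.output_cases {t : S.Thread} {r r' : Stmt S V} {o : List (Act S V)}
    (h : SStep t r o r') : o = [] ∨ ∃ c up, o = [.exec t c up] := by
  induction h with
  | com c up => exact Or.inr ⟨c, up, rfl⟩
  | seq _ _ _ _ _ _ ih => exact ih
  | _ => exact Or.inl rfl

/-- A thread executes a command, while all other threads are outside atomic blocks. -/
theorem ConfOK.exec (hB : B.full.Admissible) {w τ : Comp S (W.rt S)} {pc : PC S (W.rt S)}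
    {t : S.Thread} {c : Com S (W.rt S)} {up : List (Upd S (W.rt S))} {r : Stmt S (W.rt S)}
    [DecidableEq S.Thread]
    (hτ : EnabledAll (.exec t c up :: τ)) (hs : history τ ∈ B.full.Spec)
    (h : ConfOK B (w ++ [.exec t c up]) τ pc) (hstep : SStep t (pc t) [.exec t c up] r)
    (hl : lockset τ ⊆ {t}) (hl' : c = .endAtomic ∨ t ∈ lockset (.exec t c up :: τ)) :
    ConfOK B w (.exec t c up :: τ) (Function.update pc t r) := by
  obtain ⟨hrf, ρ, hinv, hth⟩ := h
  obtain ⟨s, Γ, Γ', hpc, hty, hsd, -⟩ := hth t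
  rw [hpc] at hstep
  obtain ⟨s', Γ₁, Γ₂, rfl, he, ht, ⟨ho, -⟩ | ⟨c, up, ho, hact⟩⟩ := hty.step hstep
  · cases ho
  simp only [List.cons.injEq, Act.exec.injEq, true_and, and_true] at ho
  obtain ⟨rfl, rfl⟩ := ho
  have hsd₁ := hsd.eps he
  -- Computations list the newest action first, so the action at the end of the remaining list is
  -- the next one in the chronological formula.
  rw [elide_append, List.reverse_append] at hinv
  obtain ⟨ρ', hρ, hinv', hsd'⟩ := hsd₁.own hB hτ.1 hτ.2 hs hact hinv
  refine ⟨⟨hrf, hsd₁.not_race hact (hrf.validInv hτ.1)⟩, ρ', hinv', fun t' => ?_⟩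
  by_cases htt : t' = t
  · subst htt
    rw [Function.update_self]
    refine ⟨s', Γ₂, Γ', rfl, ht, hsd', fun hnl => ?_⟩
    -- The acting thread is outside atomic blocks afterwards only if it executed `endAtomic`, whose
    -- rule leaves a stable environment.
    have hce := hl'.resolve_right hnl
    cases c <;> simp only [Com.map, reduceCtorEq] at hce
    cases hact with
    | endA => exact .rmTransient _
    | com _ _ hc => cases hc
  · rw [Function.update_of_ne htt]
    obtain ⟨s₁, Γ₃, Γ₄, hpc', hty', hsd₂, hst⟩ := hth t'
    -- No thread other than `t` holds the lock, so this environment is stable and interference is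
    -- harmless.
    have hst' := hst fun hm => htt (hl hm)
    exact ⟨s₁, Γ₃, Γ₄, hpc', hty',
      hsd₂.interfere htt hτ.1 hτ.2 (fun r => hρ t' r htt) hst', fun _ => hst'⟩

/-- The full computation `F` is fixed because the witness for an angel may depend on all annotations
still to come: the formula is given once for `F` and is used up action by action. -/
theorem ConfOK.step (hB : B.full.Admissible) {F : Comp S (W.rt S)} (hF : EnabledAll F)
    (hs : ∀ w τ, F = w ++ τ → history τ ∈ B.full.Spec) {pc pc' : PC S (W.rt S)}
    {τ τ' : Comp S (W.rt S)} (hstep : CStep (pc, τ) (pc', τ'))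
    (h : ∀ w, F = w ++ τ → ConfOK B w τ pc) : ∀ w, F = w ++ τ' → ConfOK B w τ' pc' := by
  classical
  intro w hw
  have hsil : ∀ t r, SStep t (pc t) [] r → F = w ++ τ →
      ConfOK B w τ (Function.update pc t r) := by
    intro t r hr hw
    obtain ⟨hrf, ρ, hinv, hth⟩ := h w hw
    refine ⟨hrf, ρ, hinv, fun t' => ?_⟩
    by_cases htt : t' = t
    · subst htt
      rw [Function.update_self]
      exact (hth t').silent hr
    · rw [Function.update_of_ne htt]
      exact hth t'
  have hsuf : EnabledAll τ' := EnabledAll.suffix (hw ▸ hF)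
  cases hstep with
  | inside _ _ t o r hr hl =>
    rcases hr.output_cases with rfl | ⟨c, up, rfl⟩
    · change ConfOK B w τ _
      exact hsil t r hr hw
    · have hw' : F = (w ++ [.exec t c up]) ++ τ := by simpa using hw
      have hc : c = .endAtomic ∨ t ∈ lockset (.exec t c up :: τ) := by
        cases c <;> simp [lockset, hl]
      change ConfOK B w (.exec t c up :: τ) _
      exact (h _ hw').exec hB hsuf (hs _ _ hw') hr hl.subset hc
  | silent _ _ t r hr hl => exact hsil t r hr hw
  | start _ _ t o r hr hl hl' =>
    rcases hr.output_cases with rfl | ⟨c, up, rfl⟩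
    · change ConfOK B w τ _
      exact hsil t r hr hw
    · have hw' : F = (w ++ [.exec t c up]) ++ τ := by simpa using hw
      change ConfOK B w (.exec t c up :: τ) _
      exact (h _ hw').exec hB hsuf (hs _ _ hw') hr (hl ▸ Set.empty_subset _)
        (Or.inr (hl'.symm.subset rfl))
  | free _ _ a hl =>
    have hw' : F = (w ++ [.free a]) ++ τ := by simpa using hw
    obtain ⟨hrf, ρ, hinv, hth⟩ := h _ hw'
    refine ⟨⟨hrf, not_race_free _ _ _⟩, ρ, by simpa [elide_append] using hinv, fun t => ?_⟩
    obtain ⟨s, Γ, Γ', hpc, hty, hsd, hst⟩ := hth t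
    exact ⟨s, Γ, Γ', hpc, hty, hsd.free hB hsuf.1 (hs _ _ hw), hst⟩

theorem spec_of_suffix {A : Aut S X Y} (hA : A.Admissible) {w τ : Comp S V}
    (h : history (w ++ τ) ∈ A.Spec) : history τ ∈ A.Spec := by
  induction w with
  | nil => exact h
  | cons act w ih =>
    refine ih ?_
    cases act with
    | exec t c up => exact hA.spec_prefix h
    | free a => exact hA.spec_prefix (h' := [.free a]) h

end SMR

theorem mainTheorem2 (S : SMR.Sig.{u}) (X Y : Type) [Finite X] [Finite Y] (B : SMR.Aut S X Y)
    (hB : B.full.Admissible) (W : SMR.PVars.{u}) (P : SMR.Stmt S W.src)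
    (hinv : ∀ σ ∈ SMR.GCSem P, SMR.InvHolds σ) (hP : SMR.TypeChecks B P) :
    ∀ τ ∈ SMR.SMRSem B.full P Set.univ ∅, SMR.RaceFree B.full τ := by
  intro F hF
  have hen := hF.1.enabledAll
  -- The initial interpretation of the angels is arbitrary, since the initial types are empty.
  have hI := hinv _ hF.1.elide (fun _ => ∅)
  obtain ⟨Γ, hΓ⟩ := hP
  have key : ∀ c : SMR.PC S (W.rt S) × SMR.Comp S (W.rt S),
      Relation.ReflTransGen SMR.CStep (fun t => P.map (W.index t), []) c →
      ∀ w, F = w ++ c.2 → SMR.ConfOK B w c.2 c.1 := by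
    intro c hc
    induction hc with
    | refl =>
      intro w hw
      have hwF : w = F := by simpa using hw.symm
      subst hwF
      exact ⟨trivial, _, hI, fun t => ⟨P, _, Γ, rfl, hΓ, .nil t _, fun _ => .empty⟩⟩
    | tail _ hstep ih =>
      exact SMR.ConfOK.step hB hen (fun w τ hw => SMR.spec_of_suffix hB (hw ▸ hF.2)) hstep ih
  cases F with
  | nil => trivial
  | cons act τ =>
    -- One execution that produces all of `F` suffices; at its end no action remains and `ConfOK`
    -- contains race freedom.
    obtain ⟨pc, hpc⟩ := hF.1.2.1
    exact (key (pc, act :: τ) hpc [] rfl).1
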